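/- **Setting.** For each sample size $n$ let $x_1,\dots,x_n\in\mathbb R^{p}$, $w_1,\dots,w_n\in\mathbb R$ and errors $\varepsilon_1,\dots,\varepsilon_n\in\mathbb R$ be random, and let $$y_i=\sum_{j=1}^{N+1}x_i^T\beta^0_{(j-1)}\mathbf 1[\tau^0_{j-1}<w_i\le\tau^0_j]+\varepsilon_i,\qquad i=1,\dots,n,$$ where $N\ge 0$, $-\infty=\tau^0_0<\tau^0_1<\dots<\tau^0_N<\tau^0_{N+1}=\infty$ and $\beta^0_{(0)},\dots,\beta^0_{(N)}\in\mathbb R^p$. Here $p,N,s\ge 1,l_{\min}>0,u_n\ge 0$, the distributions and all model parameters may depend on $n$, and $p\ge n$ for all large $n$. Let $\Phi$ be the cdf of the $w_i$ (discrete, continuous or mixed), $d(a,b)=|\Phi(b)-\Phi(a)|$ for $a,b\in[-\infty,\infty]$, $\mathcal B(a,r)=\{t\in[-\infty,\infty]: d(a,t)\le r\}$, and $\xi_{\max}=\max_{1\le j\le N}\|\beta^0_{(j)}-\beta^0_{(j-1)}\|_2$ (with $\xi_{\max}=0$ if $N=0$). For $a<b$ and $\lambda>0$, a Lasso solution on $(a,b]$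 with penalty $\lambda$ is any $$\hat\alpha\in\arg\min_{\alpha\in\mathbb R^p}\Big\{\frac1n\sum_{i=1}^n(y_i-x_i^T\alpha)^2\mathbf 1[a<w_i\le b]+\lambda\|\alpha\|_1\Big\}.$$ For $j=1,\dots,N+1$ let $\mathcal C_j$ be the set of pairs $a<b$ in $[-\infty,\infty]$ with $d(a,b)>l_{\min}$, with $a\in\mathcal B(\tau^0_{j-1},u_n)$ or $a\ge\tau^0_{j-1}$, and with $b\in\mathcal B(\tau^0_j,u_n)$ or $b\le\tau^0_j$. **Assumptions.** Fix constants $\sigma_x,\sigma_\varepsilon>0$, $0<\kappa\le\phi$, $c_0,c_0'>0$. 1. The number of coordinates $k$ with $\beta^0_{(j)k}\neq0$ for at least one $j\in\{0,\dots,N\}$ is at most $s$. 2. $s\log p/(n\,l_{\min}^2)\to 0$ as $n\to\infty$. 3. $d(\tau^0_{j-1},\tau^0_j)\ge c_0\,l_{\min}$ for $j=1,\dots,N$. 4. The $x_i$ are i.i.d. with mean zero and $E\exp(t\,v^Tx_i)\le\exp(\sigma_x^2t^2/2)$ for all $t\in\mathbb R$, $\|v\|_2=1$, and the eigenvalues of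 $E x_ix_i^T$ lie in $[\kappa,\phi]$; the $\varepsilon_i$ are i.i.d. with mean zero and $E\exp(t\varepsilon_i)\le\exp(\sigma_\varepsilon^2t^2/2)$ for all $t$; the $w_i$ are i.i.d.; the samples $(x_i)_i$, $(w_i)_i$, $(\varepsilon_i)_i$ are mutually independent. 5. $\log(u_n^{-1})=O(\log p)$ (no condition being imposed at those $n$ with $u_n=0$). 6. For all large $n$, $\xi_{\max}\frac{\log p}{n}\le c_0'\max\big\{\sqrt{\log p/n},\ \xi_{\max}u_n\big\}$ (for example, $\xi_{\max}\le c_0'\sqrt{n/\log p}$ or $u_n\ge \log p/(c_0'n)$). **Theorem.** There are constants $c_\lambda,C,c_1,c_2>0$, depending only on $\sigma_x,\sigma_\varepsilon,\kappa,\phi,c_0,c_0'$, such that for every sequence of models as above, with $$\lambda_0=c_\lambda\max\Big\{\sqrt{\tfrac{\log p}{n}},\ \xi_{\max}u_n\Big\},$$ the following holds for all sufficiently large $n$ and every $j=1,\dots,N+1$: with probability at least $1-c_1\exp(-c_2\log p)$, simultaneously for all $(\tau_a,\tau_b)\in\mathcal C_j$, every Lasso solution $\hat\alpha$ on $(\tau_a,\tau_b]$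 with penalty $\lambda_0$ satisfies $$\|\hat\alpha-\beta^0_{(j-1)}\|_q\le C\,s^{1/q}\,\max\Big\{\sqrt{\tfrac{\log p}{n}},\ \xi_{\max}u_n\Big\}\Big/l_{\min},\qquad q=1,2.$$ -/

import Mathlib

open MeasureTheory ProbabilityTheory Filter Topology
open scoped NNReal

noncomputable section

namespace ChangePoint

/-- The half-open segment `(a, b]` of the real line, with extended real end points. -/
def segment (a b : EReal) : Set ℝ := {t : ℝ | a < (t : EReal) ∧ (t : EReal) ≤ b}

/-- The `ℓ₁` norm of a vector (the norm of `EuclideanSpace` is the `ℓ₂` norm). -/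
def l1norm {p : ℕ} (v : EuclideanSpace ℝ (Fin p)) : ℝ := ∑ k, |v k|

/-- Data of a multiphase linear regression with sample size `n`, dimension `p` and `N` change
points: predictors `x`, change inducing variables `w` with common law `law`, errors `noise`,
finite change points `cp 0 < ... < cp (N - 1)` and coefficients `coef 0, ..., coef N`. -/
structure Model (Ω : Type*) [MeasurableSpace Ω] (n p N : ℕ) where
  x : Fin n → Ω → EuclideanSpace ℝ (Fin p)
  w : Fin n → Ω → ℝ
  noise : Fin n → Ω → ℝ
  law : Measure ℝ
  cp : Fin N → ℝ
  coef : Fin (N + 1) → EuclideanSpace ℝ (Fin p)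
  measurable_x : ∀ i, Measurable (x i)
  measurable_w : ∀ i, Measurable (w i)
  measurable_noise : ∀ i, Measurable (noise i)
  isProbabilityMeasure_law : IsProbabilityMeasure law
  strictMono_cp : StrictMono cp

namespace Model

variable {Ω : Type*} [MeasurableSpace Ω] {n p N : ℕ} (M : Model Ω n p N)

/-- The change points completed by `-∞` (index `0`) and `+∞` (index `N + 1`):
`M.tau j` for `1 ≤ j ≤ N` is the `j`-th change point. -/
def tau : ℕ → EReal
  | 0 => ⊥
  | j + 1 => if h : j < N then ((M.cp ⟨j, h⟩ : ℝ) : EReal) else ⊤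

/-- The response: `⟨x i, coef j⟩ + noise i` when `w i` lies in `(tau j, tau (j + 1)]`. -/
def y (i : Fin n) (ω : Ω) : ℝ :=
  ∑ j : Fin (N + 1), (segment (M.tau j) (M.tau (j + 1))).indicator
    (fun _ => inner ℝ (M.x i ω) (M.coef j)) (M.w i ω) + M.noise i ω

/-- The cdf of the change inducing variable, on the extended real line. -/
def cdf (t : EReal) : ℝ := M.law.real {r : ℝ | (r : EReal) ≤ t}

/-- The distance in the cdf scale; for `a ≤ b` it is the probability that `a < w i ≤ b`. -/
def d (a b : EReal) : ℝ := |M.cdf b - M.cdf a|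

/-- The points at cdf distance at most `r` from `c`, on either side. -/
def ball (c : EReal) (r : ℝ) : Set EReal := {t | M.d c t ≤ r}

/-- The largest jump of the coefficients; it is `0` when there is no change point. -/
def jumpMax : ℝ := ⨆ j : Fin N, ‖M.coef j.succ - M.coef j.castSucc‖

/-- The union of the supports of all coefficient vectors. -/
def support : Set (Fin p) := {k | ∃ j, M.coef j k ≠ 0}

/-- The segmentwise least squares loss. -/
def segLoss (a b : EReal) (ω : Ω) (γ : EuclideanSpace ℝ (Fin p)) : ℝ :=
  ∑ i, (segment a b).indicator (fun _ => (M.y i ω - inner ℝ (M.x i ω) γ) ^ 2) (M.w i ω)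

/-- `α` is a solution of the Lasso on the segment `(a, b]` with penalty level `lam`. -/
def IsLasso (lam : ℝ) (a b : EReal) (ω : Ω) (α : EuclideanSpace ℝ (Fin p)) : Prop :=
  ∀ γ : EuclideanSpace ℝ (Fin p),
    (1 / (n : ℝ)) * M.segLoss a b ω α + lam * l1norm α ≤
      (1 / (n : ℝ)) * M.segLoss a b ω γ + lam * l1norm γ

/-- The admissible pairs `(a, b)` for the regime `(tau j, tau (j + 1)]`, the one with coefficient
vector `coef j`: the segment has probability larger than `l`, and each end point is within cdf
distance `u` of the corresponding end of the regime or on the inner side of it. -/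
def segments (l u : ℝ) (j : Fin (N + 1)) : Set (EReal × EReal) :=
  {q | q.1 < q.2 ∧ l < M.d q.1 q.2 ∧
    ((q.1 ∈ M.ball (M.tau j) u ∧ q.2 ∈ M.ball (M.tau (j + 1)) u) ∨
     (M.tau j ≤ q.1 ∧ q.2 ∈ M.ball (M.tau (j + 1)) u) ∨
     (q.1 ∈ M.ball (M.tau j) u ∧ q.2 ≤ M.tau (j + 1)) ∨
     (M.tau j ≤ q.1 ∧ q.2 ≤ M.tau (j + 1)))}

/-- The second moment matrix of the `i`-th predictor. -/
def covMatrix (P : Measure Ω) (i : Fin n) : Matrix (Fin p) (Fin p) ℝ :=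
  Matrix.of fun k l => ∫ ω, M.x i ω k * M.x i ω l ∂P

/-- The assumptions on the distributions: i.i.d. centred subgaussian predictors whose covariance
has its eigenvalues in `[κ, φ]`, i.i.d. centred subgaussian errors, i.i.d. change inducing
variables, and independence of the three samples. -/
structure DistributionAssumptions (P : Measure Ω) (σx σε : ℝ≥0) (κ φ : ℝ) : Prop where
  indep_x : iIndepFun M.x P
  ident_x : ∀ i i', IdentDistrib (M.x i) (M.x i') P P
  mean_x : ∀ i, ∫ ω, M.x i ω ∂P = 0
  subgaussian_x : ∀ i (v : EuclideanSpace ℝ (Fin p)), ‖v‖ = 1 →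
    HasSubgaussianMGF (fun ω => inner ℝ (M.x i ω) v) (σx ^ 2) P
  -- smallest eigenvalue at least `κ`, largest at most `φ`, as bounds on the quadratic form
  eigen_lower : ∀ i (v : Fin p → ℝ), κ * (v ⬝ᵥ v) ≤ v ⬝ᵥ (M.covMatrix P i).mulVec v
  eigen_upper : ∀ i (v : Fin p → ℝ), v ⬝ᵥ (M.covMatrix P i).mulVec v ≤ φ * (v ⬝ᵥ v)
  indep_noise : iIndepFun M.noise P
  ident_noise : ∀ i i', IdentDistrib (M.noise i) (M.noise i') P P
  mean_noise : ∀ i, ∫ ω, M.noise i ω ∂P = 0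
  subgaussian_noise : ∀ i, HasSubgaussianMGF (M.noise i) (σε ^ 2) P
  indep_w : iIndepFun M.w P
  law_w : ∀ i, P.map (M.w i) = M.law
  -- mutual independence of the samples of `x`, `w` and `noise`
  indep_x_rest : IndepFun (fun ω i => M.x i ω) (fun ω => (fun i => M.w i ω, fun i => M.noise i ω)) P
  indep_w_noise : IndepFun (fun ω i => M.w i ω) (fun ω i => M.noise i ω) P

/-- The rate `max {√(log p / n), ξ_max u}`. -/
def rate (u : ℝ) : ℝ := max (√(Real.log p / n)) (M.jumpMax * u)

end Model

end ChangePoint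

end

/-! The Lasso on `(a, b]` sees the data only through the indices with `w i ∈ (a, b]`. Every nonempty
such set is one of at most `n ^ 2` blocks cut out by two observations. Since the predictors are
independent of the `w i` and of the errors, a block may be treated as a fixed index set, and
uniformity over all admissible pairs costs only a factor `n ^ 2 ≤ p ^ 2` in a union bound.

A block may contain observations from other regimes, so `coef j` is not the right centre for the
analysis. The centre is the average `γ` of the coefficient vectors governing the observations of the
block. It is supported on the common `s` coordinates. The predictors share one covariance and the
deviations from `γ` sum to zero, so the misspecification part of the score at `γ` has mean zero for
fixed `w`. Only its fluctuation has to lie below the penalty, and this is Bernstein's inequality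
(`measureReal_lt_abs_sum_inner_mul_inner_le`).

The distance from `γ` to `coef j` is at most `O * H / card`. Here `O ≤ 4 n u + 10 log p` counts the
observations that can be foreign, and `H = (1 + u / (csep l)) * jumpMax` bounds their coefficient
error: a segment that reaches several regimes away covers whole regimes, each of mass at least `csep
l`. The condition on `jumpMax * log p / n` makes this distance of order `rate / l`
(`mul_le_card_mul_rate`) and keeps the Bernstein bound of order `n * rate` (`exists_scale`).

Around `γ` the usual Lasso argument applies (`lasso_error_le`). It needs a restricted eigenvalue
bound on every block. This comes from a lower tail bound for sums of `k`, of order `s`, signed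
coordinate vectors, extended to the cone by Maurey's empirical method (`neg_mul_l1norm_sq_le`).
Blocks have at least `n l / 8` elements because every admissible segment contains one of finitely
many quantile cells (`exists_quantileCell_subset`). The triangle inequality through `γ` finishes the
proof. -/

namespace ChangePoint

/-! ### Exponential moments of subgaussian and subexponential variables. -/

section Moments

variable {Ω : Type*} [MeasurableSpace Ω] {P : Measure Ω}

/-- Comparison of the power series from the quadratic term on: as `|t / a| ≤ 1`, each power `|t / a|
^ (k + 2)` is at most `(t / a) ^ 2`. -/
theorem exp_sub_one_sub_self_le {a t w : ℝ} (ha : 0 < a) (ht : |t| ≤ a) :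
    Real.exp (t * w) - 1 - t * w ≤ (t / a) ^ 2 * Real.exp (a * |w|) := by
  have hs : ∀ y : ℝ, HasSum (fun k : ℕ => y ^ (k + 2) / ((k + 2).factorial : ℝ))
      (Real.exp y - 1 - y) := by
    intro y
    have h := NormedSpace.expSeries_div_hasSum_exp y
    rw [← Real.exp_eq_exp_ℝ] at h
    have h2 := (hasSum_nat_add_iff' 2).2 h
    simpa [Finset.sum_range_succ, sub_sub] using h2
  have h1 := hs (t * w)
  have h2 := (hs (a * |w|)).mul_left ((t / a) ^ 2)
  have h3 := hasSum_le (fun k => ?_) h1 h2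
  · refine h3.trans (mul_le_mul_of_nonneg_left ?_ (sq_nonneg _))
    have : 0 ≤ a * |w| := by positivity
    linarith
  · rw [← mul_div_assoc]
    refine div_le_div_of_nonneg_right ?_ (by positivity)
    have e : |t * w| = |t / a| * (a * |w|) := by
      rw [abs_mul, abs_div, abs_of_pos ha]; field_simp
    have hr : |t / a| ≤ 1 := by
      rw [abs_div, abs_of_pos ha]; exact (div_le_one ha).2 ht
    calc (t * w) ^ (k + 2) ≤ |t * w| ^ (k + 2) := by
          rw [← abs_pow]; exact le_abs_self _
      _ = |t / a| ^ (k + 2) * (a * |w|) ^ (k + 2) := by rw [e, mul_pow]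
      _ ≤ |t / a| ^ 2 * (a * |w|) ^ (k + 2) := by
          refine mul_le_mul_of_nonneg_right ?_ (by positivity)
          exact pow_le_pow_of_le_one (abs_nonneg _) hr (by omega)
      _ = _ := by rw [sq_abs]

/-- One exponential moment of `|W|` controls the second order remainder of the moment generating
function near zero. This is the input to Bernstein's inequality. -/
theorem integrable_exp_and_integral_exp_le [IsProbabilityMeasure P] {W : Ω → ℝ} {a t K : ℝ}
    (hW : AEMeasurable W P) (ha : 0 < a) (ht : |t| ≤ a)
    (hint : Integrable (fun ω => Real.exp (a * |W ω|)) P)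
    (hK : ∫ ω, Real.exp (a * |W ω|) ∂P ≤ K) :
    Integrable (fun ω => Real.exp (t * W ω)) P ∧
      ∫ ω, Real.exp (t * W ω) ∂P ≤ Real.exp (t * ∫ ω, W ω ∂P + K * (t / a) ^ 2) := by
  have hWi : Integrable W P := by
    refine (hint.const_mul (1 / a)).mono' hW.aestronglyMeasurable (ae_of_all _ fun ω => ?_)
    have h := Real.add_one_le_exp (a * |W ω|)
    rw [Real.norm_eq_abs, one_div, inv_mul_eq_div, le_div_iff₀ ha]
    linarith
  have hi : Integrable (fun ω => Real.exp (t * W ω)) P := by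
    refine hint.mono' (by fun_prop) (ae_of_all _ fun ω => ?_)
    rw [Real.norm_eq_abs, Real.abs_exp]
    refine Real.exp_le_exp.2 ((le_abs_self _).trans ?_)
    rw [abs_mul]
    exact mul_le_mul_of_nonneg_right ht (abs_nonneg _)
  refine ⟨hi, ?_⟩
  have h1 : ∫ ω, Real.exp (t * W ω) ∂P ≤
      ∫ ω, (1 + t * W ω) + (t / a) ^ 2 * Real.exp (a * |W ω|) ∂P := by
    refine integral_mono hi (((integrable_const _).add (hWi.const_mul _)).add (hint.const_mul _))
      fun ω => ?_
    have := exp_sub_one_sub_self_le (w := W ω) ha ht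
    simp only
    linarith
  rw [integral_add (f := fun ω => 1 + t * W ω)
      ((integrable_const _).add (hWi.const_mul _)) (hint.const_mul _),
    integral_add (integrable_const _) (hWi.const_mul _), integral_const_mul,
    integral_const_mul] at h1
  simp only [integral_const, probReal_univ, smul_eq_mul, mul_one] at h1
  have h2 := mul_le_mul_of_nonneg_left hK (sq_nonneg (t / a))
  have h3 := Real.add_one_le_exp (t * ∫ ω, W ω ∂P + K * (t / a) ^ 2)
  linarith

/-- Completing the square writes `exp (x ^ 2 / (4 c))` as a Gaussian mixture of the exponentials
`exp (g x)`, to which a subgaussian bound applies for each `g`. -/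
theorem integral_exp_mul_sub_mul_sq {c : ℝ} (hc : 0 < c) (x : ℝ) :
    Integrable (fun g : ℝ => Real.exp (g * x - c * g ^ 2)) ∧
    ∫ g : ℝ, Real.exp (g * x - c * g ^ 2) = Real.exp (x ^ 2 / (4 * c)) * √(Real.pi / c) := by
  have e : (fun g : ℝ => Real.exp (g * x - c * g ^ 2)) =
      fun g => Real.exp (x ^ 2 / (4 * c)) * Real.exp (-c * (g - x / (2 * c)) ^ 2) := by
    funext g
    rw [← Real.exp_add]
    congr 1
    field_simp
    ring
  rw [e]
  refine ⟨((integrable_exp_neg_mul_sq hc).comp_sub_right (x / (2 * c))).const_mul _, ?_⟩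
  rw [integral_const_mul, integral_sub_right_eq_self (fun g => Real.exp (-c * g ^ 2)),
    integral_gaussian]

/-- The square of a subgaussian variable has an exponential moment. -/
theorem _root_.ProbabilityTheory.HasSubgaussianMGF.exp_sq [IsProbabilityMeasure P] {X : Ω → ℝ}
    {c : ℝ≥0} (h : HasSubgaussianMGF X c P) (hc : 0 < c) :
    Integrable (fun ω => Real.exp (X ω ^ 2 / (4 * c))) P ∧
      ∫ ω, Real.exp (X ω ^ 2 / (4 * c)) ∂P ≤ 2 := by
  have hc' : (0 : ℝ) < c := hc
  have hX := h.aemeasurable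
  have hpos : 0 < √(Real.pi / c) := Real.sqrt_pos.2 (by positivity)
  have key : ∫⁻ ω, ENNReal.ofReal (Real.exp (X ω ^ 2 / (4 * c)) * √(Real.pi / c)) ∂P ≤
      ENNReal.ofReal √(Real.pi / (c / 2)) := by
    calc ∫⁻ ω, ENNReal.ofReal (Real.exp (X ω ^ 2 / (4 * c)) * √(Real.pi / c)) ∂P
        = ∫⁻ ω, (∫⁻ g : ℝ, ENNReal.ofReal (Real.exp (g * X ω - c * g ^ 2))) ∂P := by
          refine lintegral_congr fun ω => ?_
          obtain ⟨h1, h2⟩ := integral_exp_mul_sub_mul_sq hc' (X ω)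
          rw [← h2, ofReal_integral_eq_lintegral_ofReal h1
            (ae_of_all _ fun g => (Real.exp_pos _).le)]
      _ = ∫⁻ g : ℝ, ∫⁻ ω, ENNReal.ofReal (Real.exp (g * X ω - c * g ^ 2)) ∂P := by
          refine lintegral_lintegral_swap ?_
          refine AEMeasurable.ennreal_ofReal (Real.measurable_exp.comp_aemeasurable ?_)
          have h1 : AEMeasurable (fun z : Ω × ℝ => X z.1) (P.prod volume) :=
            hX.comp_quasiMeasurePreserving Measure.quasiMeasurePreserving_fst
          have h2 : AEMeasurable (fun z : Ω × ℝ => z.2 * X z.1 - c * z.2 ^ 2) (P.prod volume) := by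
            fun_prop
          exact h2
      _ ≤ ∫⁻ g : ℝ, ENNReal.ofReal (Real.exp (-(c / 2) * g ^ 2)) := by
          refine lintegral_mono fun g => ?_
          have e : (fun ω => Real.exp (g * X ω - c * g ^ 2)) =
              fun ω => Real.exp (-(c * g ^ 2)) * Real.exp (g * X ω) := by
            funext ω; rw [← Real.exp_add]; congr 1; ring
          have hi := (h.integrable_exp_mul g).const_mul (Real.exp (-(c * g ^ 2)))
          rw [← ofReal_integral_eq_lintegral_ofReal (by rw [e]; exact hi)
            (ae_of_all _ fun ω => (Real.exp_pos _).le), e, integral_const_mul]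
          refine ENNReal.ofReal_le_ofReal ?_
          have h2 := h.mgf_le g
          rw [mgf] at h2
          refine (mul_le_mul_of_nonneg_left h2 (Real.exp_pos _).le).trans_eq ?_
          rw [← Real.exp_add]; congr 1; ring
      _ = ENNReal.ofReal √(Real.pi / (c / 2)) := by
          rw [← ofReal_integral_eq_lintegral_ofReal (integrable_exp_neg_mul_sq (by positivity))
            (ae_of_all _ fun ω => (Real.exp_pos _).le), integral_gaussian]
  have hm : AEStronglyMeasurable (fun ω => Real.exp (X ω ^ 2 / (4 * c)) * √(Real.pi / c)) P := by
    have : AEMeasurable (fun ω => Real.exp (X ω ^ 2 / (4 * c)) * √(Real.pi / c)) P := by fun_prop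
    exact this.aestronglyMeasurable
  have hi : Integrable (fun ω => Real.exp (X ω ^ 2 / (4 * c)) * √(Real.pi / c)) P := by
    refine ⟨hm, ?_⟩
    rw [hasFiniteIntegral_iff_ofReal (ae_of_all _ fun ω => by positivity)]
    exact key.trans_lt ENNReal.ofReal_lt_top
  have hi' : Integrable (fun ω => Real.exp (X ω ^ 2 / (4 * c))) P := by
    have := hi.mul_const (√(Real.pi / c))⁻¹
    simpa only [mul_inv_cancel_right₀ hpos.ne'] using this
  refine ⟨hi', ?_⟩
  rw [← ofReal_integral_eq_lintegral_ofReal hi (ae_of_all _ fun ω => by positivity),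
    ENNReal.ofReal_le_ofReal_iff (Real.sqrt_nonneg _), integral_mul_const] at key
  have e : √(Real.pi / (c / 2)) = √2 * √(Real.pi / c) := by
    rw [← Real.sqrt_mul (by norm_num)]; congr 1; field_simp
  rw [e] at key
  have h4 := le_of_mul_le_mul_right key hpos
  refine h4.trans ?_
  rw [Real.sqrt_le_left (by norm_num)]
  norm_num

theorem exp_mul_abs_mul_le {a b : ℝ≥0} (ha : 0 < a) (hb : 0 < b) (x y : ℝ) :
    Real.exp (1 / (4 * a * b) * |x * y|) ≤
      (Real.exp (x ^ 2 / (4 * (a ^ 2 : ℝ≥0))) + Real.exp (y ^ 2 / (4 * (b ^ 2 : ℝ≥0)))) / 2 := by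
  have ha' : (0 : ℝ) < a := ha
  have hb' : (0 : ℝ) < b := hb
  set A := x ^ 2 / (4 * ((a ^ 2 : ℝ≥0) : ℝ)) with hA
  set B := y ^ 2 / (4 * ((b ^ 2 : ℝ≥0) : ℝ)) with hB
  have h1 : 1 / (4 * a * b) * |x * y| ≤ A / 2 + B / 2 := by
    have h := sq_nonneg (|x| / a - |y| / b)
    have e1 : A = (|x| / a) ^ 2 / 4 := by
      rw [hA, div_pow, sq_abs]; push_cast; field_simp
    have e2 : B = (|y| / b) ^ 2 / 4 := by
      rw [hB, div_pow, sq_abs]; push_cast; field_simp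
    have e3 : 1 / (4 * a * b) * |x * y| = (|x| / a) * (|y| / b) / 4 := by
      rw [abs_mul]; field_simp
    rw [e1, e2, e3]
    nlinarith
  have h2 : Real.exp (A / 2 + B / 2) = Real.exp (A / 2) * Real.exp (B / 2) := Real.exp_add _ _
  have h3 : Real.exp A = Real.exp (A / 2) ^ 2 := by
    rw [← Real.exp_nat_mul]; congr 1; push_cast; ring
  have h4 : Real.exp B = Real.exp (B / 2) ^ 2 := by
    rw [← Real.exp_nat_mul]; congr 1; push_cast; ring
  refine (Real.exp_le_exp.2 h1).trans ?_
  rw [h2, h3, h4]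
  nlinarith [sq_nonneg (Real.exp (A / 2) - Real.exp (B / 2))]

/-- The product of two subgaussian variables is subexponential. -/
theorem _root_.ProbabilityTheory.HasSubgaussianMGF.exp_mul [IsProbabilityMeasure P]
    {X Y : Ω → ℝ} {a b : ℝ≥0} (hX : HasSubgaussianMGF X (a ^ 2) P)
    (hY : HasSubgaussianMGF Y (b ^ 2) P) (ha : 0 < a) (hb : 0 < b) :
    Integrable (fun ω => Real.exp (1 / (4 * a * b) * |X ω * Y ω|)) P ∧
      ∫ ω, Real.exp (1 / (4 * a * b) * |X ω * Y ω|) ∂P ≤ 2 := by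
  obtain ⟨h1, h2⟩ := hX.exp_sq (by positivity)
  obtain ⟨h3, h4⟩ := hY.exp_sq (by positivity)
  have hXm := hX.aemeasurable
  have hYm := hY.aemeasurable
  have hi : Integrable (fun ω => Real.exp (1 / (4 * a * b) * |X ω * Y ω|)) P := by
    have hm : AEMeasurable (fun ω => Real.exp (1 / (4 * a * b) * |X ω * Y ω|)) P := by fun_prop
    refine ((h1.add h3).div_const 2).mono' hm.aestronglyMeasurable (ae_of_all _ fun ω => ?_)
    rw [Real.norm_eq_abs, Real.abs_exp]
    exact exp_mul_abs_mul_le ha hb _ _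
  refine ⟨hi, ?_⟩
  have := integral_mono hi ((h1.add h3).div_const 2)
    (fun ω => exp_mul_abs_mul_le ha hb (X ω) (Y ω))
  simp only [Pi.add_apply] at this
  rw [integral_div, integral_add h1 h3] at this
  linarith

/-- Chernoff's bound for a sum of independent variables. -/
theorem measureReal_le_sum_le_exp {ι : Type*} {Y : ι → Ω → ℝ}
    (hY : iIndepFun Y P) (hm : ∀ i, Measurable (Y i)) (A : Finset ι) {a : ι → ℝ}
    (hint : ∀ i ∈ A, Integrable (fun ω => Real.exp (Y i ω)) P)
    (ha : ∀ i ∈ A, ∫ ω, Real.exp (Y i ω) ∂P ≤ Real.exp (a i)) (T : ℝ) :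
    P.real {ω | T ≤ ∑ i ∈ A, Y i ω} ≤ Real.exp (∑ i ∈ A, a i - T) := by
  have := hY.isProbabilityMeasure
  have h1 := measure_ge_le_exp_mul_mgf (μ := P) (X := ∑ i ∈ A, Y i) (t := 1) T zero_le_one
    (hY.integrable_exp_mul_sum hm fun i hi => by simpa using hint i hi)
  rw [hY.mgf_sum hm] at h1
  simp only [Finset.sum_apply] at h1
  refine h1.trans ?_
  rw [sub_eq_neg_add, Real.exp_add, Real.exp_sum, neg_one_mul]
  refine mul_le_mul_of_nonneg_left ?_ (Real.exp_pos _).le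
  refine Finset.prod_le_prod (fun i _ => mgf_nonneg) fun i hi => ?_
  simpa [mgf] using ha i hi

end Moments

/-! ### Maurey's empirical method and the deterministic Lasso bound. -/

section Deterministic

/-- If `k` is drawn with probabilities `w k`, the right-hand side bounds the mean of the left-hand
side, so some `k` does at least as well. Neither symmetry nor positivity of `B` enters, which
matters because `B` will be a Gram form minus a multiple of the inner product. -/
theorem exists_bilin_add_smul_le {E ι : Type*} [AddCommGroup E] [Module ℝ E] [Fintype ι]
    (B : E →ₗ[ℝ] E →ₗ[ℝ] ℝ) (a : ι → E) (w : ι → ℝ) (hw : ∀ k, 0 ≤ w k) (hw1 : ∑ k, w k = 1)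
    {D : ℝ} (hD : ∀ k, B (a k) (a k) ≤ D) (b : E) (t : ℝ) :
    ∃ k, B (b + t • a k) (b + t • a k) ≤
      B (b + t • ∑ k, w k • a k) (b + t • ∑ k, w k • a k) +
        t ^ 2 * (D - B (∑ k, w k • a k) (∑ k, w k • a k)) := by
  set v := ∑ k, w k • a k with hv
  by_contra! hcon
  have h1 : ∀ u, B (b + t • u) (b + t • u) =
      B b b + t * (B b u + B u b) + t ^ 2 * B u u := by
    intro u
    simp only [map_add, map_smul, LinearMap.add_apply, LinearMap.smul_apply, smul_eq_mul]
    ring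
  simp only [h1] at hcon
  have h2 : ∑ k, w k * (B b (a k) + B (a k) b) = B b v + B v b := by
    rw [hv]
    simp only [map_sum, map_smul, LinearMap.sum_apply, LinearMap.smul_apply, smul_eq_mul, mul_add,
      Finset.sum_add_distrib]
  have h3 : ∀ k, w k * (t * (B b v + B v b) + t ^ 2 * D) ≤
      w k * (t * (B b (a k) + B (a k) b) + t ^ 2 * D) := by
    intro k
    refine mul_le_mul_of_nonneg_left ?_ (hw k)
    have e := hcon k
    have e2 := mul_le_mul_of_nonneg_left (hD k) (sq_nonneg t)
    linarith
  obtain ⟨k₀, hk₀⟩ : ∃ k, 0 < w k := by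
    by_contra! h
    have : ∑ k, w k ≤ 0 := Finset.sum_nonpos fun k _ => h k
    linarith
  have h4 : ∑ k, w k * (t * (B b v + B v b) + t ^ 2 * D) <
      ∑ k, w k * (t * (B b (a k) + B (a k) b) + t ^ 2 * D) := by
    refine Finset.sum_lt_sum (fun k _ => h3 k) ⟨k₀, Finset.mem_univ _, ?_⟩
    refine mul_lt_mul_of_pos_left ?_ hk₀
    have e := hcon k₀
    have e2 := mul_le_mul_of_nonneg_left (hD k₀) (sq_nonneg t)
    linarith
  have h5 : ∑ k, w k * (t * (B b (a k) + B (a k) b) + t ^ 2 * D) =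
      t * (B b v + B v b) + t ^ 2 * D := by
    rw [← h2, Finset.mul_sum]
    have : ∑ k, w k * (t ^ 2 * D) = t ^ 2 * D := by rw [← Finset.sum_mul, hw1, one_mul]
    nth_rw 2 [← this]
    rw [← Finset.sum_add_distrib]
    exact Finset.sum_congr rfl fun k _ => by ring
  rw [h5, ← Finset.sum_mul, hw1, one_mul] at h4
  exact lt_irrefl _ h4

/-- Derandomized sampling: the `m` draws are fixed one at a time, each costing at most the variance
term. -/
theorem exists_bilin_sum_le {E ι : Type*} [AddCommGroup E] [Module ℝ E] [Fintype ι]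
    (B : E →ₗ[ℝ] E →ₗ[ℝ] ℝ) (a : ι → E) (w : ι → ℝ) (hw : ∀ k, 0 ≤ w k) (hw1 : ∑ k, w k = 1)
    {D : ℝ} (hD : ∀ k, B (a k) (a k) ≤ D) (m : ℕ) :
    ∀ b : E, ∃ f : Fin m → ι, B (b + ∑ i, a (f i)) (b + ∑ i, a (f i)) ≤
      B (b + (m : ℝ) • ∑ k, w k • a k) (b + (m : ℝ) • ∑ k, w k • a k) +
        m * (D - B (∑ k, w k • a k) (∑ k, w k • a k)) := by
  set v := ∑ k, w k • a k with hv
  induction m with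
  | zero => intro b; exact ⟨Fin.elim0, by simp⟩
  | succ m ih =>
    intro b
    obtain ⟨k, hk⟩ := exists_bilin_add_smul_le B a w hw hw1 hD (b + (m : ℝ) • v) 1
    obtain ⟨f, hf⟩ := ih (b + a k)
    refine ⟨Fin.cons k f, ?_⟩
    rw [← hv] at hk
    simp only [one_smul, one_pow, one_mul] at hk
    have e1 : b + ∑ i : Fin (m + 1), a ((Fin.cons k f : Fin (m + 1) → ι) i) =
        b + a k + ∑ i, a (f i) := by
      rw [Fin.sum_univ_succ]; simp [add_assoc]
    have e2 : b + (m : ℝ) • v + a k = b + a k + (m : ℝ) • v := by abel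
    have e3 : b + (m : ℝ) • v + v = b + ((m + 1 : ℕ) : ℝ) • v := by
      push_cast; rw [add_smul, one_smul, add_assoc]
    rw [e2, e3] at hk
    rw [e1]
    push_cast at *
    linarith

variable {p : ℕ}

theorem l1norm_nonneg (v : EuclideanSpace ℝ (Fin p)) : 0 ≤ l1norm v :=
  Finset.sum_nonneg fun _ _ => abs_nonneg _

theorem l1norm_add_le (v w : EuclideanSpace ℝ (Fin p)) : l1norm (v + w) ≤ l1norm v + l1norm w := by
  rw [l1norm, l1norm, l1norm, ← Finset.sum_add_distrib]
  exact Finset.sum_le_sum fun k _ => by simpa using abs_add_le (v k) (w k)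

theorem sum_abs_le_sqrt_card_mul_norm (S : Finset (Fin p)) (v : EuclideanSpace ℝ (Fin p)) :
    ∑ k ∈ S, |v k| ≤ √(S.card : ℝ) * ‖v‖ := by
  rw [EuclideanSpace.norm_eq, ← Real.sqrt_mul (by positivity)]
  refine Real.le_sqrt_of_sq_le ?_
  refine sq_sum_le_card_mul_sum_sq.trans (mul_le_mul_of_nonneg_left ?_ (by positivity))
  simp only [Real.norm_eq_abs]
  exact Finset.sum_le_sum_of_subset_of_nonneg (Finset.subset_univ _) fun _ _ _ => sq_nonneg _

/-- The coordinate vectors and their opposites. -/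
noncomputable def signedBasis (p : ℕ) (k : Fin p × Bool) : EuclideanSpace ℝ (Fin p) :=
  EuclideanSpace.single k.1 (if k.2 then 1 else -1)

theorem inner_signedBasis_sq (v : EuclideanSpace ℝ (Fin p)) (k : Fin p × Bool) :
    inner ℝ v (signedBasis p k) ^ 2 = v k.1 ^ 2 := by
  rw [signedBasis]
  rcases k with ⟨k, b⟩
  cases b <;> simp [EuclideanSpace.inner_single_right]

/-- The transfer principle: lower bounds of a quadratic form on sums of `m` signed coordinate
vectors extend to all vectors up to a term in the `ℓ₁` norm. -/
theorem neg_mul_l1norm_sq_le {ι : Type*} (A : Finset ι) (x : ι → EuclideanSpace ℝ (Fin p))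
    {c D : ℝ} (hc : 0 ≤ c) {m : ℕ} (hm : 0 < m)
    (hsparse : ∀ f : Fin m → Fin p × Bool, c * ‖∑ i, signedBasis p (f i)‖ ^ 2 ≤
      ∑ i ∈ A, inner ℝ (x i) (∑ i, signedBasis p (f i)) ^ 2)
    (hdiag : ∀ k, ∑ i ∈ A, x i k ^ 2 ≤ D) (v : EuclideanSpace ℝ (Fin p)) :
    -(D * l1norm v ^ 2) ≤ (m - 1) * (∑ i ∈ A, inner ℝ (x i) v ^ 2 - c * ‖v‖ ^ 2) := by
  let B : EuclideanSpace ℝ (Fin p) →ₗ[ℝ] EuclideanSpace ℝ (Fin p) →ₗ[ℝ] ℝ :=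
    LinearMap.mk₂ ℝ (fun u v => ∑ i ∈ A, inner ℝ (x i) u * inner ℝ (x i) v - c * inner ℝ u v)
      (fun u u' v => by
        simp only [inner_add_right, inner_add_left, add_mul, Finset.sum_add_distrib]; ring)
      (fun r u v => by
        simp only [inner_smul_right, real_inner_smul_left, smul_eq_mul, mul_sub, Finset.mul_sum]
        congr 1
        · exact Finset.sum_congr rfl fun i _ => by ring
        · ring)
      (fun u v v' => by
        simp only [inner_add_right, mul_add, Finset.sum_add_distrib]; ring)
      (fun r u v => by
        simp only [inner_smul_right, smul_eq_mul, mul_sub, Finset.mul_sum]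
        congr 1
        · exact Finset.sum_congr rfl fun i _ => by ring
        · ring)
  have hB : ∀ u, B u u = ∑ i ∈ A, inner ℝ (x i) u ^ 2 - c * ‖u‖ ^ 2 := by
    intro u
    simp only [B, LinearMap.mk₂_apply, real_inner_self_eq_norm_sq, sq]
  rcases eq_or_ne (l1norm v) 0 with h0 | h0
  · have hv : v = 0 := by
      ext k
      have := (Finset.sum_eq_zero_iff_of_nonneg (fun k _ => abs_nonneg (v k))).1 h0 k
        (Finset.mem_univ _)
      simpa using this
    simp [hv, l1norm]
  have hpos : 0 < l1norm v := lt_of_le_of_ne (l1norm_nonneg v) h0.symm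
  set L := l1norm v with hL
  -- `v / L` is a convex combination, with weights `|v k| / L`, of coordinate vectors carrying the
  -- signs of `v`.
  let a : Fin p → EuclideanSpace ℝ (Fin p) := fun k => signedBasis p (k, decide (0 ≤ v k))
  have hsum : ∑ k, (|v k| / L) • a k = L⁻¹ • v := by
    ext l
    simp only [a, signedBasis, WithLp.ofLp_sum, WithLp.ofLp_smul, Finset.sum_apply, Pi.smul_apply,
      smul_eq_mul, decide_eq_true_eq, PiLp.single_apply, PiLp.smul_apply]
    rw [Finset.sum_eq_single l (fun k _ hk => by simp [hk.symm]) (by simp)]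
    rcases le_or_gt 0 (v l) with h | h
    · simp [h, abs_of_nonneg h]; ring
    · simp [h.not_ge, abs_of_neg h]; ring
  have hD' : ∀ k, B (a k) (a k) ≤ D := by
    intro k
    rw [hB]
    simp only [a, inner_signedBasis_sq]
    have := mul_nonneg hc (sq_nonneg ‖signedBasis p (k, decide (0 ≤ v k))‖)
    linarith [hdiag k]
  obtain ⟨f, hf⟩ := exists_bilin_sum_le B a (fun k => |v k| / L)
    (fun k => by positivity) (by rw [← Finset.sum_div]; exact div_self h0) hD' m 0
  rw [hsum] at hf
  simp only [zero_add] at hf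
  have h1 : 0 ≤ B (∑ i, a (f i)) (∑ i, a (f i)) := by
    rw [hB, sub_nonneg]; exact hsparse fun i => (f i, decide (0 ≤ v (f i)))
  have h2 : ∀ r : ℝ, B (r • v) (r • v) = r ^ 2 * B v v := by
    intro r
    simp only [map_smul, LinearMap.smul_apply, smul_eq_mul]; ring
  rw [smul_smul, h2, h2] at hf
  rw [← hB]
  have hm' : (0 : ℝ) < m := by exact_mod_cast hm
  have h3 : 0 ≤ (m * L⁻¹) ^ 2 * B v v + m * (D - L⁻¹ ^ 2 * B v v) := h1.trans hf
  have h4 : (m * L⁻¹) ^ 2 * B v v + m * (D - L⁻¹ ^ 2 * B v v) =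
      m / L ^ 2 * ((m - 1) * B v v + D * L ^ 2) := by
    field_simp; ring
  rw [h4] at h3
  have h5 := nonneg_of_mul_nonneg_right h3 (by positivity)
  linarith

/-- The deterministic error bound of the Lasso around an approximate target `γ`. -/
theorem lasso_error_le {ι : Type*} (A : Finset ι) (x : ι → EuclideanSpace ℝ (Fin p)) (y : ι → ℝ)
    {n s lam μ : ℝ} (hn : 0 < n) (hμ : 0 < μ) (hlam : 0 < lam)
    (S : Finset (Fin p)) (hS : (S.card : ℝ) ≤ s) (γ α : EuclideanSpace ℝ (Fin p))
    (hγ : ∀ k ∉ S, γ k = 0)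
    (hopt : 1 / n * ∑ i ∈ A, (y i - inner ℝ (x i) α) ^ 2 + lam * l1norm α ≤
      1 / n * ∑ i ∈ A, (y i - inner ℝ (x i) γ) ^ 2 + lam * l1norm γ)
    (hscore : ∀ k, |∑ i ∈ A, (y i - inner ℝ (x i) γ) * x i k| ≤ n * lam / 4)
    (hre : ∀ v, l1norm v ^ 2 ≤ 16 * s * ‖v‖ ^ 2 →
      μ * n * ‖v‖ ^ 2 ≤ ∑ i ∈ A, inner ℝ (x i) v ^ 2) :
    ‖α - γ‖ ≤ 3 / 2 * lam * √s / μ ∧ l1norm (α - γ) ≤ 4 * √s * ‖α - γ‖ := by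
  set δ := α - γ with hδ
  set a := ∑ k ∈ S, |δ k| with ha
  set b := ∑ k ∈ Sᶜ, |δ k| with hb
  have ha0 : 0 ≤ a := Finset.sum_nonneg fun _ _ => abs_nonneg _
  have hb0 : 0 ≤ b := Finset.sum_nonneg fun _ _ => abs_nonneg _
  have hab : l1norm δ = a + b := (Finset.sum_add_sum_compl S _).symm
  have hs0 : 0 ≤ s := le_trans (by positivity) hS
  have has : a ≤ √s * ‖δ‖ := (sum_abs_le_sqrt_card_mul_norm S δ).trans
    (mul_le_mul_of_nonneg_right (Real.sqrt_le_sqrt hS) (norm_nonneg _))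
  have h1 : l1norm γ - l1norm α ≤ a - b := by
    rw [l1norm, l1norm, ← Finset.sum_sub_distrib,
      ← Finset.sum_add_sum_compl S (fun k => |γ k| - |α k|), ha, hb, sub_eq_add_neg,
      ← Finset.sum_neg_distrib]
    refine add_le_add (Finset.sum_le_sum fun k _ => ?_) (Finset.sum_le_sum fun k hk => ?_)
    · have := abs_sub_abs_le_abs_sub (γ k) (α k)
      simpa [hδ, abs_sub_comm] using this
    · have := hγ k (by simpa using hk)
      simp [hδ, this]
  have hexp : ∑ i ∈ A, (y i - inner ℝ (x i) α) ^ 2 = ∑ i ∈ A, (y i - inner ℝ (x i) γ) ^ 2 -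
      2 * ∑ i ∈ A, (y i - inner ℝ (x i) γ) * inner ℝ (x i) δ +
        ∑ i ∈ A, inner ℝ (x i) δ ^ 2 := by
    rw [Finset.mul_sum, ← Finset.sum_sub_distrib, ← Finset.sum_add_distrib]
    refine Finset.sum_congr rfl fun i _ => ?_
    rw [hδ, inner_sub_right]; ring
  have hlin : ∑ i ∈ A, (y i - inner ℝ (x i) γ) * inner ℝ (x i) δ ≤ n * lam / 4 * (a + b) := by
    have e : ∑ i ∈ A, (y i - inner ℝ (x i) γ) * inner ℝ (x i) δ =
        ∑ k, (∑ i ∈ A, (y i - inner ℝ (x i) γ) * x i k) * δ k := by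
      simp only [Finset.sum_mul]
      rw [Finset.sum_comm]
      refine Finset.sum_congr rfl fun i _ => ?_
      rw [PiLp.inner_apply (x i) δ, Finset.mul_sum]
      exact Finset.sum_congr rfl fun k _ => by simp; ring
    rw [e, ← hab, l1norm, Finset.mul_sum]
    refine Finset.sum_le_sum fun k _ => (le_abs_self _).trans ?_
    rw [abs_mul]
    exact mul_le_mul_of_nonneg_right (hscore k) (abs_nonneg _)
  set R := ∑ i ∈ A, inner ℝ (x i) δ ^ 2 with hR
  have hR0 : 0 ≤ R := Finset.sum_nonneg fun _ _ => sq_nonneg _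
  -- The cross term contributes at most `2 * (n lam / 4) * (a + b)`, half of the penalty scale,
  -- which leaves the coefficients `3/2` and `-1/2`.
  have hmain : R ≤ n * lam * (3 / 2 * a - b / 2) := by
    rw [hexp] at hopt
    have e : 1 / n * R ≤ 1 / n * (2 * (n * lam / 4 * (a + b))) + lam * (a - b) := by
      have e1 := mul_le_mul_of_nonneg_left h1 hlam.le
      have e2 := mul_le_mul_of_nonneg_left hlin (by positivity : 0 ≤ 1 / n * 2)
      linarith
    have e3 := mul_le_mul_of_nonneg_left e hn.le
    have e4 : n * (1 / n * R) = R := by field_simp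
    have e5 : n * (1 / n * (2 * (n * lam / 4 * (a + b))) + lam * (a - b)) =
        n * lam * (3 / 2 * a - b / 2) := by field_simp; ring
    rwa [e4, e5] at e3
  have hδ0 := norm_nonneg δ
  have hsq0 := Real.sqrt_nonneg s
  -- Since `R ≥ 0`, the error lies in the cone where the restricted eigenvalue bound is available.
  have hcone : b ≤ 3 * a := by
    have := nonneg_of_mul_nonneg_right (hR0.trans hmain) (by positivity : 0 < n * lam)
    linarith
  have hl1 : l1norm δ ≤ 4 * √s * ‖δ‖ := by rw [hab]; linarith
  refine ⟨?_, hl1⟩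
  have hre' := hre δ (by
    have := pow_le_pow_left₀ (l1norm_nonneg δ) hl1 2
    rw [mul_pow, mul_pow, Real.sq_sqrt hs0] at this
    linarith)
  rw [le_div_iff₀ hμ]
  rcases hδ0.eq_or_lt with h0 | h0
  · rw [← h0, zero_mul]; positivity
  have h6 : n * ‖δ‖ * (‖δ‖ * μ) ≤ n * ‖δ‖ * (3 / 2 * lam * √s) := by
    have e1 : n * lam * (3 / 2 * a - b / 2) ≤ n * lam * (3 / 2 * (√s * ‖δ‖)) :=
      mul_le_mul_of_nonneg_left (by linarith) (by positivity)
    calc _ = μ * n * ‖δ‖ ^ 2 := by ring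
      _ ≤ _ := hre'.trans (hmain.trans e1)
      _ = _ := by ring
  exact le_of_mul_le_mul_left h6 (by positivity)

end Deterministic

/-! ### Masses of sets exhausted by rays, and tail bounds for sums over a fixed index set. -/

section Tails

/-- The `I t` are rays in one direction. If no single ray based in `A` covers `A`, the rays based at
a countable dense subset of `A` exhaust it and are directed, so the mass is a supremum. This
replaces the inversion of the cdf, which may have jumps and flat parts. -/
theorem measure_le_of_forall_measure_inter_le {μ : Measure ℝ} {A : Set ℝ} {I : ℝ → Set ℝ}
    (hself : ∀ t, t ∈ I t) (hclosed : ∀ t, IsClosed (I t)) (htrans : ∀ t u, u ∈ I t → I u ⊆ I t)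
    (htotal : ∀ t u, u ∉ I t → I t ⊆ I u) {c : ENNReal} (h : ∀ t ∈ A, μ (A ∩ I t) ≤ c) :
    μ A ≤ c := by
  by_cases hmax : ∃ t ∈ A, A ⊆ I t
  · obtain ⟨t, ht, hA⟩ := hmax
    have := h t ht
    rwa [Set.inter_eq_left.2 hA] at this
  push Not at hmax
  obtain ⟨D, hDA, hDc, hAD⟩ :=
    (TopologicalSpace.IsSeparable.of_separableSpace A).exists_countable_dense_subset
  have hcov : A ⊆ ⋃ d ∈ D, A ∩ I d := by
    intro t ht
    obtain ⟨u, hu, hut⟩ := Set.not_subset.1 (hmax t ht)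
    obtain ⟨d, hd, hdD⟩ := mem_closure_iff.1 (hAD hu) _ (hclosed t).isOpen_compl hut
    exact Set.mem_biUnion hdD ⟨ht, htotal t d hd (hself t)⟩
  refine (measure_mono hcov).trans ?_
  rw [measure_biUnion_eq_iSup hDc]
  · exact iSup₂_le fun d hd => h d (hDA hd)
  · intro d hd d' hd'
    by_cases hdd : d' ∈ I d
    · exact ⟨d, hd, subset_rfl, Set.inter_subset_inter_right _ (htrans d d' hdd)⟩
    · exact ⟨d', hd', Set.inter_subset_inter_right _ (htotal d d' hdd), subset_rfl⟩

theorem measure_le_of_forall_measure_inter_Iic_le {μ : Measure ℝ} {A : Set ℝ} {c : ENNReal}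
    (h : ∀ t ∈ A, μ (A ∩ Set.Iic t) ≤ c) : μ A ≤ c :=
  measure_le_of_forall_measure_inter_le (I := Set.Iic) (fun _ => Set.self_mem_Iic) (fun _ => isClosed_Iic)
    (fun _ _ h => Set.Iic_subset_Iic.2 h) (fun _ _ h => Set.Iic_subset_Iic.2 (not_le.1 h).le) h

theorem measure_le_of_forall_measure_inter_Ici_le {μ : Measure ℝ} {A : Set ℝ} {c : ENNReal}
    (h : ∀ t ∈ A, μ (A ∩ Set.Ici t) ≤ c) : μ A ≤ c :=
  measure_le_of_forall_measure_inter_le (I := Set.Ici) (fun _ => Set.self_mem_Ici) (fun _ => isClosed_Ici)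
    (fun _ _ h => Set.Ici_subset_Ici.2 h) (fun _ _ h => Set.Ici_subset_Ici.2 (not_le.1 h).le) h

variable {Ω : Type*} [MeasurableSpace Ω] {P : Measure Ω}

/-- A probability bound that holds for each value of an independent variable holds jointly. -/
theorem _root_.ProbabilityTheory.IndepFun.measureReal_mem_le [IsProbabilityMeasure P]
    {𝒳 𝒴 : Type*} [MeasurableSpace 𝒳] [MeasurableSpace 𝒴]
    {X : Ω → 𝒳} {Y : Ω → 𝒴} (h : IndepFun X Y P) (hX : Measurable X) (hY : Measurable Y)
    {B : Set (𝒳 × 𝒴)} (hB : MeasurableSet B) {δ : ℝ}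
    (hδ : ∀ y, P.real {ω | (X ω, y) ∈ B} ≤ δ) : P.real {ω | (X ω, Y ω) ∈ B} ≤ δ := by
  have hδ0 : 0 ≤ δ := by
    obtain ⟨ω⟩ : Nonempty Ω := P.nonempty_of_neZero
    exact measureReal_nonneg.trans (hδ (Y ω))
  have hprod := (indepFun_iff_map_prod_eq_prod_map_map hX.aemeasurable hY.aemeasurable).1 h
  have hYp : IsProbabilityMeasure (P.map Y) := Measure.isProbabilityMeasure_map hY.aemeasurable
  have hXp : IsProbabilityMeasure (P.map X) := Measure.isProbabilityMeasure_map hX.aemeasurable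
  refine ENNReal.toReal_le_of_le_ofReal hδ0 ?_
  have e : P {ω | (X ω, Y ω) ∈ B} = P.map (fun ω => (X ω, Y ω)) B := by
    rw [Measure.map_apply (hX.prodMk hY) hB]; rfl
  rw [e, hprod, Measure.prod_apply_symm hB]
  calc ∫⁻ y, P.map X ((fun x => (x, y)) ⁻¹' B) ∂(P.map Y)
      ≤ ∫⁻ _, ENNReal.ofReal δ ∂(P.map Y) := by
        refine lintegral_mono fun y => ?_
        rw [Measure.map_apply hX (measurable_prodMk_right hB)]
        rw [← ofReal_measureReal]
        exact ENNReal.ofReal_le_ofReal (hδ y)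
    _ = ENNReal.ofReal δ := by simp

/-- Sums of squares of independent subgaussian variables. -/
theorem measureReal_lt_sum_sq_le {ι : Type*} {X : ι → Ω → ℝ} (hX : iIndepFun X P)
    (hm : ∀ i, Measurable (X i)) {σ : ℝ≥0} (hσ : 0 < σ)
    (hsub : ∀ i, HasSubgaussianMGF (X i) (σ ^ 2) P) (A : Finset ι) :
    P.real {ω | 8 * (σ : ℝ) ^ 2 * A.card < ∑ i ∈ A, X i ω ^ 2} ≤ Real.exp (-A.card) := by
  have := hX.isProbabilityMeasure
  have hσ' : (0 : ℝ) < σ := hσ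
  have h2 : (2 : ℝ) ≤ Real.exp 1 := by have := Real.add_one_le_exp (1 : ℝ); linarith
  -- Each summand has exponential moment at most `2 ≤ e`, so the threshold `2 * card` leaves the
  -- exponent `card - 2 * card`.
  have h1 := measureReal_le_sum_le_exp
    (Y := fun i ω => X i ω ^ 2 / (4 * ((σ ^ 2 : ℝ≥0) : ℝ)))
    (hX.comp (fun _ z => z ^ 2 / (4 * ((σ ^ 2 : ℝ≥0) : ℝ))) fun _ => by fun_prop)
    (fun i => by have := hm i; fun_prop) A (a := fun _ => 1)
    (fun i _ => ((hsub i).exp_sq (by positivity)).1)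
    (fun i _ => ((hsub i).exp_sq (by positivity)).2.trans h2) (2 * A.card)
  have e : ∑ i ∈ A, (1 : ℝ) - 2 * A.card = -A.card := by simp; ring
  rw [e] at h1
  refine (measureReal_mono fun ω hω => ?_).trans h1
  simp only [Set.mem_ofPred_eq] at hω ⊢
  rw [← Finset.sum_div, le_div_iff₀ (by positivity)]
  push_cast
  linarith

variable {p : ℕ}

theorem hasSubgaussianMGF_inner [IsProbabilityMeasure P] {x : Ω → EuclideanSpace ℝ (Fin p)}
    {σ : ℝ≥0}
    (hsub : ∀ v, ‖v‖ = 1 → HasSubgaussianMGF (fun ω => inner ℝ (x ω) v) (σ ^ 2) P)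
    (v : EuclideanSpace ℝ (Fin p)) :
    HasSubgaussianMGF (fun ω => inner ℝ (x ω) v) ((‖v‖₊ * σ) ^ 2) P := by
  rcases eq_or_ne v 0 with rfl | hv
  · simp
  have h0 : ‖v‖ ≠ 0 := norm_ne_zero_iff.2 hv
  have h := (hsub (‖v‖⁻¹ • v) (by rw [norm_smul, norm_inv, norm_norm, inv_mul_cancel₀ h0])).const_mul
    ‖v‖
  have e : (fun ω => ‖v‖ * inner ℝ (x ω) (‖v‖⁻¹ • v)) = fun ω => inner ℝ (x ω) v := by
    funext ω; rw [inner_smul_right, mul_inv_cancel_left₀ h0]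
  rw [e] at h
  convert h using 1
  rw [mul_pow]
  congr 1

/-- The Bernstein moment bound with `a = 1 / (4 σ² ‖v‖)` and `K = 2`, so that `K (t / a) ^ 2 = 32 σ⁴
‖v‖² t²`. -/
theorem integrable_exp_inner_mul_inner [IsProbabilityMeasure P]
    {x : Ω → EuclideanSpace ℝ (Fin p)} {σ : ℝ≥0} (hσ : 0 < σ)
    (hsub : ∀ v, ‖v‖ = 1 → HasSubgaussianMGF (fun ω => inner ℝ (x ω) v) (σ ^ 2) P)
    (v e : EuclideanSpace ℝ (Fin p)) (he : ‖e‖ = 1) {t : ℝ}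
    (ht : |t| * (4 * (σ : ℝ) ^ 2 * ‖v‖) ≤ 1) :
    Integrable (fun ω => Real.exp (t * (inner ℝ (x ω) v * inner ℝ (x ω) e))) P ∧
      ∫ ω, Real.exp (t * (inner ℝ (x ω) v * inner ℝ (x ω) e)) ∂P ≤
        Real.exp (t * ∫ ω, inner ℝ (x ω) v * inner ℝ (x ω) e ∂P +
          32 * (σ : ℝ) ^ 4 * ‖v‖ ^ 2 * t ^ 2) := by
  rcases eq_or_ne v 0 with rfl | hv
  · simp
  have hσ' : (0 : ℝ) < σ := hσ
  have h0 : 0 < ‖v‖ := norm_pos_iff.2 hv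
  have hX := hasSubgaussianMGF_inner hsub v
  have hY := hsub e he
  obtain ⟨h1, h2⟩ := hX.exp_mul hY (mul_pos (by simpa using hv) hσ) hσ
  have h3 := integrable_exp_and_integral_exp_le (t := t)
    (hX.aemeasurable.mul hY.aemeasurable) (by push_cast; positivity) ?_ h1 h2
  · refine ⟨h3.1, h3.2.trans_eq ?_⟩
    congr 2
    push_cast
    field_simp
    ring
  · push_cast
    rw [le_div_iff₀ (by positivity)]
    linarith

variable {ι : Type*} {x : ι → Ω → EuclideanSpace ℝ (Fin p)} {σ : ℝ≥0}

/-- Chernoff's bound at `-θ` in the unit direction of `z`: the second order term is at most `θ κ /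
4`, so each log moment is at most `-3 θ κ / 4`, and the threshold returns `θ κ / 2`. -/
theorem measureReal_sum_inner_sq_lt_le (hind : iIndepFun x P) (hm : ∀ i, Measurable (x i))
    (hσ : 0 < σ)
    (hsub : ∀ i v, ‖v‖ = 1 → HasSubgaussianMGF (fun ω => inner ℝ (x i ω) v) (σ ^ 2) P)
    {κ θ : ℝ} (hθ : 0 < θ) (hθσ : θ * (4 * (σ : ℝ) ^ 2) ≤ 1) (hθκ : 128 * (σ : ℝ) ^ 4 * θ ≤ κ)
    (hκ : ∀ i v, κ * ‖v‖ ^ 2 ≤ ∫ ω, inner ℝ (x i ω) v ^ 2 ∂P)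
    (A : Finset ι) (z : EuclideanSpace ℝ (Fin p)) :
    P.real {ω | ∑ i ∈ A, inner ℝ (x i ω) z ^ 2 < κ / 2 * A.card * ‖z‖ ^ 2} ≤
      Real.exp (-(θ * κ / 4) * A.card) := by
  have := hind.isProbabilityMeasure
  rcases eq_or_ne z 0 with rfl | hz
  · simp [Real.exp_nonneg]
  have h0 : 0 < ‖z‖ := norm_pos_iff.2 hz
  set e : EuclideanSpace ℝ (Fin p) := ‖z‖⁻¹ • z with he
  have hen : ‖e‖ = 1 := by rw [he, norm_smul, norm_inv, norm_norm, inv_mul_cancel₀ h0.ne']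
  have hmgf := fun i => integrable_exp_inner_mul_inner hσ (hsub i) e e hen (t := -θ)
    (by rw [hen, abs_neg, abs_of_pos hθ]; linarith)
  have h1 := measureReal_le_sum_le_exp
    (Y := fun i ω => -θ * (inner ℝ (x i ω) e * inner ℝ (x i ω) e))
    (hind.comp (fun _ z => -θ * (inner ℝ z e * inner ℝ z e)) fun _ => by fun_prop)
    (fun i => by have := hm i; fun_prop) A (a := fun _ => -(3 / 4 * θ * κ))
    (fun i _ => (hmgf i).1)
    (fun i _ => (hmgf i).2.trans (Real.exp_le_exp.2 ?_)) (-(θ * κ / 2) * A.card)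
  · refine (measureReal_mono fun ω hω => ?_).trans (h1.trans_eq ?_)
    · simp only [Set.mem_ofPred_eq] at hω ⊢
      rw [← Finset.mul_sum]
      have e1 : ∑ i ∈ A, inner ℝ (x i ω) e * inner ℝ (x i ω) e =
          (∑ i ∈ A, inner ℝ (x i ω) z ^ 2) / ‖z‖ ^ 2 := by
        rw [Finset.sum_div]
        refine Finset.sum_congr rfl fun i _ => ?_
        rw [he, inner_smul_right]
        field_simp
      have e2 : (∑ i ∈ A, inner ℝ (x i ω) z ^ 2) / ‖z‖ ^ 2 ≤ κ / 2 * A.card := by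
        rw [div_le_iff₀ (by positivity)]; exact hω.le
      rw [e1]
      have := mul_le_mul_of_nonneg_left e2 hθ.le
      linarith
    · congr 1
      rw [Finset.sum_const, nsmul_eq_mul]
      ring
  · have h2 := hκ i e
    rw [hen, one_pow, mul_one] at h2
    simp only [sq] at h2
    have h3 := mul_le_mul_of_nonneg_left h2 hθ.le
    have h4 := mul_le_mul_of_nonneg_left hθκ hθ.le
    rw [hen]
    nlinarith

theorem measureReal_lt_abs_le [IsProbabilityMeasure P] {S : Ω → ℝ} {T δ : ℝ}
    (h1 : P.real {ω | T ≤ S ω} ≤ δ) (h2 : P.real {ω | T ≤ -S ω} ≤ δ) :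
    P.real {ω | T < |S ω|} ≤ 2 * δ := by
  have : {ω | T < |S ω|} ⊆ {ω | T ≤ S ω} ∪ {ω | T ≤ -S ω} := by
    intro ω hω
    rcases lt_abs.1 (show T < |S ω| from hω) with h | h
    · exact Or.inl h.le
    · exact Or.inr h.le
  refine (measureReal_mono this).trans ((measureReal_union_le _ _).trans ?_)
  linarith

/-- The weights `c` are the errors, frozen by independence; `t` is left free to be tuned to their
energy `V`. -/
theorem measureReal_lt_abs_sum_mul_inner_le (hind : iIndepFun x P) (hm : ∀ i, Measurable (x i))
    (hsub : ∀ i v, ‖v‖ = 1 → HasSubgaussianMGF (fun ω => inner ℝ (x i ω) v) (σ ^ 2) P)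
    (A : Finset ι) (c : ι → ℝ) {V t T L : ℝ} (hV : ∑ i ∈ A, c i ^ 2 ≤ V)
    (hL : (σ : ℝ) ^ 2 * t ^ 2 * V / 2 - t * T ≤ -L) (ht : 0 < t)
    (e : EuclideanSpace ℝ (Fin p)) (he : ‖e‖ = 1) :
    P.real {ω | T < |∑ i ∈ A, c i * inner ℝ (x i ω) e|} ≤ 2 * Real.exp (-L) := by
  have := hind.isProbabilityMeasure
  have key : ∀ t' : ℝ, t' ^ 2 = t ^ 2 →
      P.real {ω | t * T ≤ ∑ i ∈ A, t' * c i * inner ℝ (x i ω) e} ≤ Real.exp (-L) := by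
    intro t' ht'
    have h1 := measureReal_le_sum_le_exp
      (Y := fun i ω => t' * c i * inner ℝ (x i ω) e)
      (hind.comp (fun i z => t' * c i * inner ℝ z e) fun _ => by fun_prop)
      (fun i => by have := hm i; fun_prop) A (a := fun i => (σ : ℝ) ^ 2 * (t' * c i) ^ 2 / 2)
      (fun i _ => (hsub i e he).integrable_exp_mul _)
      (fun i _ => by simpa [mgf] using (hsub i e he).mgf_le (t' * c i)) (t * T)
    refine h1.trans (Real.exp_le_exp.2 (le_trans ?_ hL))
    have : ∑ i ∈ A, (σ : ℝ) ^ 2 * (t' * c i) ^ 2 / 2 =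
        (σ : ℝ) ^ 2 * t ^ 2 / 2 * ∑ i ∈ A, c i ^ 2 := by
      rw [Finset.mul_sum]
      exact Finset.sum_congr rfl fun i _ => by rw [mul_pow, ht']; ring
    rw [this]
    have := mul_le_mul_of_nonneg_left hV (by positivity : 0 ≤ (σ : ℝ) ^ 2 * t ^ 2 / 2)
    linarith
  refine measureReal_lt_abs_le ?_ ?_
  · refine (measureReal_mono fun ω hω => ?_).trans (key t rfl)
    simp only [Set.mem_ofPred_eq, mul_assoc, ← Finset.mul_sum] at hω ⊢
    exact mul_le_mul_of_nonneg_left hω ht.le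
  · refine (measureReal_mono fun ω hω => ?_).trans (key (-t) (by ring))
    simp only [Set.mem_ofPred_eq, mul_assoc, ← Finset.mul_sum] at hω ⊢
    have := mul_le_mul_of_nonneg_left hω ht.le
    linarith

/-- The individual terms are not centred, but their means add up to the common second moment form
evaluated at `∑ v i = 0`. This cancellation is why the analysis is centred at the average
coefficient. -/
theorem measureReal_lt_abs_sum_inner_mul_inner_le (hind : iIndepFun x P)
    (hm : ∀ i, Measurable (x i)) (hident : ∀ i i', IdentDistrib (x i) (x i') P P) (hσ : 0 < σ)
    (hsub : ∀ i v, ‖v‖ = 1 → HasSubgaussianMGF (fun ω => inner ℝ (x i ω) v) (σ ^ 2) P)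
    (A : Finset ι) (v : ι → EuclideanSpace ℝ (Fin p)) (hv0 : ∑ i ∈ A, v i = 0) {Q V L : ℝ}
    (hQ : 0 < Q) (hvQ : ∀ i ∈ A, ‖v i‖ ≤ 2 * Q) (hV : ∑ i ∈ A, ‖v i‖ ^ 2 ≤ Q * V)
    (e : EuclideanSpace ℝ (Fin p)) (he : ‖e‖ = 1) :
    P.real {ω | 8 * (σ : ℝ) ^ 2 * (Q * L + V / 2) <
        |∑ i ∈ A, inner ℝ (x i ω) (v i) * inner ℝ (x i ω) e|} ≤ 2 * Real.exp (-L) := by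
  have := hind.isProbabilityMeasure
  have hσ' : (0 : ℝ) < σ := hσ
  have hmean : ∑ i ∈ A, ∫ ω, inner ℝ (x i ω) (v i) * inner ℝ (x i ω) e ∂P = 0 := by
    rcases A.eq_empty_or_nonempty with rfl | ⟨i₀, hi₀⟩
    · simp
    have h1 : ∀ i, ∫ ω, inner ℝ (x i ω) (v i) * inner ℝ (x i ω) e ∂P =
        ∫ ω, inner ℝ (x i₀ ω) (v i) * inner ℝ (x i₀ ω) e ∂P := fun i =>
      ((hident i i₀).comp (u := fun z => inner ℝ z (v i) * inner ℝ z e) (by fun_prop)).integral_eq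
    have h2 : ∀ i, Integrable (fun ω => inner ℝ (x i₀ ω) (v i) * inner ℝ (x i₀ ω) e) P :=
      fun i => MemLp.integrable_mul (p := 2) (q := 2)
        (by exact_mod_cast (hasSubgaussianMGF_inner (hsub i₀) (v i)).memLp 2)
        (by exact_mod_cast (hsub i₀ e he).memLp 2)
    simp only [h1]
    rw [← integral_finsetSum _ fun i _ => h2 i]
    simp only [← Finset.sum_mul, ← inner_sum, hv0, inner_zero_right, zero_mul, integral_zero]
  -- The largest parameter allowed by the moment bound when `‖v i‖ ≤ 2 * Q`.
  set t : ℝ := 1 / (8 * (σ : ℝ) ^ 2 * Q) with ht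
  have ht0 : 0 < t := by positivity
  have key : ∀ t' : ℝ, |t'| = t →
      P.real {ω | t * (8 * (σ : ℝ) ^ 2 * (Q * L + V / 2)) ≤
        ∑ i ∈ A, t' * (inner ℝ (x i ω) (v i) * inner ℝ (x i ω) e)} ≤ Real.exp (-L) := by
    intro t' ht'
    have hmgf := fun i (hi : i ∈ A) => integrable_exp_inner_mul_inner hσ (hsub i) (v i) e he
      (t := t') (by
        rw [ht', ht, one_div, inv_mul_le_iff₀ (by positivity)]
        have := mul_le_mul_of_nonneg_left (hvQ i hi) (by positivity : 0 ≤ 4 * (σ : ℝ) ^ 2)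
        linarith)
    have h1 := measureReal_le_sum_le_exp
      (Y := fun i ω => t' * (inner ℝ (x i ω) (v i) * inner ℝ (x i ω) e))
      (hind.comp (fun i z => t' * (inner ℝ z (v i) * inner ℝ z e)) fun _ => by fun_prop)
      (fun i => by have := hm i; fun_prop) A
      (fun i hi => (hmgf i hi).1) (fun i hi => (hmgf i hi).2)
      (t * (8 * (σ : ℝ) ^ 2 * (Q * L + V / 2)))
    refine h1.trans (Real.exp_le_exp.2 ?_)
    rw [Finset.sum_add_distrib, ← Finset.mul_sum, hmean, mul_zero, zero_add, ← Finset.sum_mul,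
      ← Finset.mul_sum, ← sq_abs t', ht']
    have h2 : 32 * (σ : ℝ) ^ 4 * (∑ i ∈ A, ‖v i‖ ^ 2) * t ^ 2 ≤
        32 * (σ : ℝ) ^ 4 * (Q * V) * t ^ 2 :=
      mul_le_mul_of_nonneg_right (mul_le_mul_of_nonneg_left hV (by positivity)) (by positivity)
    have h3 : 32 * (σ : ℝ) ^ 4 * (Q * V) * t ^ 2 - t * (8 * (σ : ℝ) ^ 2 * (Q * L + V / 2)) =
        -L := by
      rw [ht]; field_simp; ring
    linarith
  refine measureReal_lt_abs_le ?_ ?_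
  · refine (measureReal_mono fun ω hω => ?_).trans (key t (abs_of_pos ht0))
    simp only [Set.mem_ofPred_eq, ← Finset.mul_sum] at hω ⊢
    exact mul_le_mul_of_nonneg_left hω ht0.le
  · refine (measureReal_mono fun ω hω => ?_).trans (key (-t) (by rw [abs_neg, abs_of_pos ht0]))
    simp only [Set.mem_ofPred_eq, ← Finset.mul_sum] at hω ⊢
    have := mul_le_mul_of_nonneg_left hω ht0.le
    linarith

/-- Upper tail of the number of sample points in a set. -/
theorem measureReal_le_card_le [IsProbabilityMeasure P] {n : ℕ} {w : Fin n → Ω → ℝ}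
    (hind : iIndepFun w P) (hm : ∀ i, Measurable (w i)) {μ : Measure ℝ}
    (hlaw : ∀ i, P.map (w i) = μ) {S : Set ℝ} (hS : MeasurableSet S) {θ : ℝ} (T : ℝ) :
    P.real {ω | T ≤ θ * ∑ i, S.indicator (fun _ => (1 : ℝ)) (w i ω)} ≤
      Real.exp (n * (μ.real S * (Real.exp θ - 1)) - T) := by
  have h1 := measureReal_le_sum_le_exp
    (Y := fun i ω => θ * S.indicator (fun _ => (1 : ℝ)) (w i ω))
    (hind.comp (fun i z => θ * S.indicator (fun _ => (1 : ℝ)) z)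
      fun _ => measurable_const.mul (measurable_const.indicator hS))
    (fun i => measurable_const.mul ((measurable_const.indicator hS).comp (hm i))) Finset.univ
    (a := fun _ => μ.real S * (Real.exp θ - 1)) ?_ ?_ T
  · simpa [← Finset.mul_sum] using h1
  all_goals
    intro i _
    have e : (fun ω => Real.exp (θ * S.indicator (fun _ => (1 : ℝ)) (w i ω))) =
        fun ω => 1 + (w i ⁻¹' S).indicator (fun _ => Real.exp θ - 1) ω := by
      funext ω
      by_cases h : w i ω ∈ S
      · rw [Set.indicator_of_mem h, Set.indicator_of_mem (show ω ∈ w i ⁻¹' S from h)]; simp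
      · rw [Set.indicator_of_notMem h, Set.indicator_of_notMem (show ω ∉ w i ⁻¹' S from h)]; simp
    have hi : Integrable ((w i ⁻¹' S).indicator (fun _ => Real.exp θ - 1)) P :=
      (integrable_const _).indicator (hm i hS)
  · rw [e]
    exact (integrable_const _).add hi
  · rw [e, integral_add (integrable_const _) hi, integral_indicator_const _ (hm i hS)]
    have hμ : P.real (w i ⁻¹' S) = μ.real S := by
      rw [← hlaw i, measureReal_def, measureReal_def, Measure.map_apply (hm i) hS]
    rw [hμ]
    have := Real.add_one_le_exp (μ.real S * (Real.exp θ - 1))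
    simp only [integral_const, probReal_univ, smul_eq_mul, mul_one]
    linarith

end Tails

/-! ### Geometry of the regimes in the cdf scale: excess sets and quantile cells. -/

theorem measurableSet_segment (a b : EReal) : MeasurableSet (segment a b) :=
  (measurableSet_lt measurable_const measurable_coe_real_ereal).inter
    (measurableSet_le measurable_coe_real_ereal measurable_const)

namespace Model

variable {Ω : Type*} [MeasurableSpace Ω] {n p N : ℕ} (M : Model Ω n p N)

instance : IsProbabilityMeasure M.law := M.isProbabilityMeasure_law

/-- The coefficient vector that governs an observation with change inducing variable `t`. -/
noncomputable def coefAt (t : ℝ) : EuclideanSpace ℝ (Fin p) :=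
  ∑ j : Fin (N + 1), (segment (M.tau j) (M.tau (j + 1))).indicator (fun _ => M.coef j) t

theorem measurable_coefAt : Measurable M.coefAt :=
  Finset.measurable_sum _ fun _ _ => measurable_const.indicator (measurableSet_segment _ _)

theorem y_eq (i : Fin n) (ω : Ω) :
    M.y i ω = inner ℝ (M.x i ω) (M.coefAt (M.w i ω)) + M.noise i ω := by
  rw [y, coefAt, inner_sum]
  congr 1
  refine Finset.sum_congr rfl fun j _ => ?_
  by_cases h : M.w i ω ∈ segment (M.tau j) (M.tau (j + 1)) <;> simp [h]

theorem tau_mono : Monotone M.tau := by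
  refine monotone_nat_of_le_succ fun j => ?_
  rcases j with _ | j
  · exact bot_le
  · simp only [tau]
    split_ifs with h1 h2 h2
    · exact EReal.coe_le_coe_iff.2 (M.strictMono_cp.monotone (by simp))
    · exact le_top
    · omega
    · exact le_rfl

theorem tau_last : M.tau (N + 1) = ⊤ := by simp [tau]

theorem exists_mem_segment (t : ℝ) : ∃ k : Fin (N + 1),
    t ∈ segment (M.tau k) (M.tau (k + 1)) ∧ M.coefAt t = M.coef k := by
  classical
  have hex : ∃ m, (t : EReal) ≤ M.tau m := ⟨N + 1, by rw [tau_last]; exact le_top⟩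
  obtain ⟨m, hm⟩ : ∃ m, Nat.find hex = m + 1 := by
    refine Nat.exists_eq_succ_of_ne_zero fun h0 => ?_
    have := Nat.find_spec hex
    rw [h0] at this
    simp [tau] at this
  have h1 : (t : EReal) ≤ M.tau (m + 1) := by rw [← hm]; exact Nat.find_spec hex
  have h2 : M.tau m < t := not_le.1 (Nat.find_min hex (by omega))
  have hmN : m < N + 1 := by
    by_contra! h
    exact h2.not_ge ((by rw [tau_last]; exact le_top : (t : EReal) ≤ M.tau (N + 1)).trans
      (M.tau_mono h))
  refine ⟨⟨m, hmN⟩, ⟨h2, h1⟩, ?_⟩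
  rw [coefAt, Finset.sum_eq_single ⟨m, hmN⟩]
  · exact Set.indicator_of_mem (show t ∈ segment _ _ from ⟨h2, h1⟩) _
  · intro k _ hk
    refine Set.indicator_of_notMem ?_ _
    rintro ⟨h3, h4⟩
    have hk' : (k : ℕ) ≠ m := fun h => hk (Fin.ext h)
    rcases lt_or_gt_of_ne hk' with h | h
    · exact (h4.trans (M.tau_mono h)).not_gt h2
    · exact (h1.trans (M.tau_mono h)).not_gt h3
  · simp

theorem cdf_mono : Monotone M.cdf := fun _ _ hab =>
  measureReal_mono fun _ hr => le_trans hr hab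

theorem cdf_nonneg (t : EReal) : 0 ≤ M.cdf t := measureReal_nonneg

theorem cdf_le_one (t : EReal) : M.cdf t ≤ 1 := measureReal_le_one

theorem d_le_one (a b : EReal) : M.d a b ≤ 1 := by
  rw [d, abs_sub_le_iff]
  constructor <;> linarith [M.cdf_nonneg a, M.cdf_nonneg b, M.cdf_le_one a, M.cdf_le_one b]

theorem d_of_le {a b : EReal} (h : a ≤ b) : M.d a b = M.cdf b - M.cdf a :=
  abs_of_nonneg (sub_nonneg.2 (M.cdf_mono h))

theorem law_segment {a b : EReal} (h : a ≤ b) : M.law.real (segment a b) = M.cdf b - M.cdf a := by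
  have e : segment a b = {r : ℝ | (r : EReal) ≤ b} \ {r : ℝ | (r : EReal) ≤ a} := by
    ext t
    simp only [segment, Set.mem_ofPred_eq, Set.mem_sdiff, not_le]
    exact and_comm
  rw [e, measureReal_sdiff (s₁ := {r : ℝ | (r : EReal) ≤ b}) (s₂ := {r : ℝ | (r : EReal) ≤ a})
    (fun r hr => le_trans hr h) (measurableSet_le measurable_coe_real_ereal measurable_const)]
  rfl

theorem jumpMax_nonneg : 0 ≤ M.jumpMax := Real.iSup_nonneg fun _ => norm_nonneg _

theorem norm_coef_sub_le_of_le {i k : ℕ} (hik : i ≤ k) (hk : k < N + 1) :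
    ‖M.coef ⟨k, hk⟩ - M.coef ⟨i, by omega⟩‖ ≤ (k - i) * M.jumpMax := by
  induction k, hik using Nat.le_induction with
  | base => simp
  | succ k hik ih =>
    have h1 : ‖M.coef ⟨k + 1, hk⟩ - M.coef ⟨k, by omega⟩‖ ≤ M.jumpMax :=
      le_ciSup (f := fun j : Fin N => ‖M.coef j.succ - M.coef j.castSucc‖)
        (Set.finite_range _).bddAbove ⟨k, by omega⟩
    have h2 := ih (by omega)
    have h3 := norm_sub_le_norm_sub_add_norm_sub (M.coef ⟨k + 1, hk⟩) (M.coef ⟨k, by omega⟩)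
      (M.coef ⟨i, by omega⟩)
    push_cast
    linarith

theorem mul_le_cdf_sub {c : ℝ} (hc : ∀ j : Fin N, c ≤ M.d (M.tau j) (M.tau (j + 1))) {i k : ℕ}
    (hik : i ≤ k) (hk : k < N + 1) : (k - i) * c ≤ M.cdf (M.tau k) - M.cdf (M.tau i) := by
  induction k, hik using Nat.le_induction with
  | base => simp
  | succ k hik ih =>
    have h1 := hc ⟨k, by omega⟩
    rw [d_of_le _ (M.tau_mono (Nat.le_succ _))] at h1
    have h2 := ih (by omega)
    push_cast
    simp only at h1
    linarith

/-- The points below the `j`-th regime that an admissible segment can reach. -/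
def leftExcess (u : ℝ) (j : Fin (N + 1)) : Set ℝ :=
  {t | (t : EReal) ≤ M.tau j ∧ ∃ a < (t : EReal), a ∈ M.ball (M.tau j) u}

/-- The points above the `j`-th regime that an admissible segment can reach. -/
def rightExcess (u : ℝ) (j : Fin (N + 1)) : Set ℝ :=
  {t | M.tau (j + 1) < (t : EReal) ∧ ∃ b, (t : EReal) ≤ b ∧ b ∈ M.ball (M.tau (j + 1)) u}

theorem measurableSet_leftExcess (u : ℝ) (j : Fin (N + 1)) :
    MeasurableSet (M.leftExcess u j) := by
  refine Set.OrdConnected.measurableSet (Set.ordConnected_def.2 ?_)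
  rintro t ⟨_, a, ha, hau⟩ t' ⟨ht', _⟩ r ⟨h1, h2⟩
  exact ⟨(EReal.coe_le_coe_iff.2 h2).trans ht', a, ha.trans_le (EReal.coe_le_coe_iff.2 h1), hau⟩

theorem measurableSet_rightExcess (u : ℝ) (j : Fin (N + 1)) :
    MeasurableSet (M.rightExcess u j) := by
  refine Set.OrdConnected.measurableSet (Set.ordConnected_def.2 ?_)
  rintro t ⟨ht, _⟩ t' ⟨_, b, hb, hbu⟩ r ⟨h1, h2⟩
  exact ⟨ht.trans_le (EReal.coe_le_coe_iff.2 h1), b, (EReal.coe_le_coe_iff.2 h2).trans hb, hbu⟩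

/-- No extreme end point of the ball need be attained, so the mass is bounded on rays: the part to
the right of a point `t` of the set lies in one segment `(a, tau j]` of mass at most `u`. -/
theorem law_leftExcess_le {u : ℝ} (hu : 0 ≤ u) (j : Fin (N + 1)) :
    M.law.real (M.leftExcess u j) ≤ u := by
  refine ENNReal.toReal_le_of_le_ofReal hu
    (measure_le_of_forall_measure_inter_Ici_le fun t ht => ?_)
  obtain ⟨ht, a, ha, hau⟩ := ht
  have haj : a ≤ M.tau j := ha.le.trans ht
  rw [← ofReal_measureReal]
  refine ENNReal.ofReal_le_ofReal ?_
  refine (measureReal_mono (s₂ := segment a (M.tau j)) ?_).trans ?_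
  · rintro r ⟨⟨h1, _⟩, h2⟩
    exact ⟨ha.trans_le (EReal.coe_le_coe_iff.2 h2), h1⟩
  · rw [law_segment _ haj]
    have : M.d (M.tau j) a ≤ u := hau
    rw [d, abs_le] at this
    linarith

theorem law_rightExcess_le {u : ℝ} (hu : 0 ≤ u) (j : Fin (N + 1)) :
    M.law.real (M.rightExcess u j) ≤ u := by
  refine ENNReal.toReal_le_of_le_ofReal hu
    (measure_le_of_forall_measure_inter_Iic_le fun t ht => ?_)
  obtain ⟨ht, b, hb, hbu⟩ := ht
  have hbj : M.tau (j + 1) ≤ b := ht.le.trans hb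
  rw [← ofReal_measureReal]
  refine ENNReal.ofReal_le_ofReal ?_
  refine (measureReal_mono (s₂ := segment (M.tau (j + 1)) b) ?_).trans ?_
  · rintro r ⟨⟨h1, _⟩, h2⟩
    exact ⟨h1, (EReal.coe_le_coe_iff.2 h2).trans hb⟩
  · rw [law_segment _ hbj]
    have : M.d (M.tau (j + 1)) b ≤ u := hbu
    rw [d, abs_le] at this
    linarith

/-- If `t` lies several regimes away, the regimes strictly in between have mass at least `csep * l`
each and total mass at most `u`. Hence at most `1 + u / (csep * l)` jumps separate the two
coefficient vectors. -/
theorem norm_coefAt_sub_le {l u csep : ℝ} (hl : 0 < l) (hcsep : 0 < csep)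
    (hsep : ∀ j : Fin N, csep * l ≤ M.d (M.tau j) (M.tau (j + 1))) {j : Fin (N + 1)}
    {q : EReal × EReal} (hq : q ∈ M.segments l u j) {t : ℝ} (ht : t ∈ segment q.1 q.2) :
    (t ∉ M.leftExcess u j → t ∉ M.rightExcess u j → M.coefAt t = M.coef j) ∧
      (0 ≤ u → ‖M.coefAt t - M.coef j‖ ≤ (1 + u / (csep * l)) * M.jumpMax) := by
  obtain ⟨-, -, hq⟩ := hq
  obtain ⟨hq1, hq2⟩ := ht
  obtain ⟨k, ⟨hk1, hk2⟩, hk⟩ := M.exists_mem_segment t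
  have hc : 0 < csep * l := by positivity
  have hξ := M.jumpMax_nonneg
  rw [hk]
  rcases lt_trichotomy (k : ℕ) j with hkj | hkj | hkj
  · have htj : (t : EReal) ≤ M.tau j := hk2.trans (M.tau_mono hkj)
    have hball : q.1 ∈ M.ball (M.tau j) u := by
      have := (hq1.trans_le htj).not_ge
      tauto
    refine ⟨fun h => absurd ⟨htj, q.1, hq1, hball⟩ h, fun hu => ?_⟩
    have h1 := M.mul_le_cdf_sub hsep (i := k + 1) (k := j) hkj j.2
    have h2 : M.d (M.tau j) q.1 ≤ u := hball
    rw [d, abs_le] at h2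
    have h3 := M.cdf_mono (hq1.le.trans hk2)
    have h4 := M.norm_coef_sub_le_of_le hkj.le j.2
    rw [norm_sub_rev] at h4
    refine h4.trans (mul_le_mul_of_nonneg_right ?_ hξ)
    have h5 : ((j : ℕ) : ℝ) - ((k + 1 : ℕ) : ℝ) ≤ u / (csep * l) := by
      rw [le_div_iff₀ hc]; linarith
    push_cast at h5
    linarith
  · have : k = j := Fin.ext hkj
    subst this
    refine ⟨fun _ _ => rfl, fun hu => ?_⟩
    rw [sub_self, norm_zero]
    positivity
  · have htj : M.tau (j + 1) < (t : EReal) := (M.tau_mono hkj).trans_lt hk1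
    have hball : q.2 ∈ M.ball (M.tau (j + 1)) u := by
      have := (htj.trans_le hq2).not_ge
      tauto
    refine ⟨fun _ h => absurd ⟨htj, q.2, hq2, hball⟩ h, fun hu => ?_⟩
    have h1 := M.mul_le_cdf_sub hsep (i := j + 1) (k := k) hkj k.2
    have h2 : M.d (M.tau (j + 1)) q.2 ≤ u := hball
    rw [d, abs_le] at h2
    have h3 := M.cdf_mono (hk1.le.trans hq2)
    have h4 := M.norm_coef_sub_le_of_le hkj.le k.2
    refine h4.trans (mul_le_mul_of_nonneg_right ?_ hξ)
    have h5 : ((k : ℕ) : ℝ) - ((j + 1 : ℕ) : ℝ) ≤ u / (csep * l) := by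
      rw [le_div_iff₀ hc]; linarith
    push_cast at h5
    linarith

/-- The part of the line between the quantiles of level `k η` and `(k + 2) η`. -/
def quantileCell (η : ℝ) (k : ℕ) : Set ℝ :=
  {t | k * η ≤ M.cdf t ∧ M.law.real (Set.Iio t) < (k + 2) * η}

theorem measurable_cdf_coe : Measurable fun t : ℝ => M.cdf t :=
  Monotone.measurable fun _ _ h => M.cdf_mono (EReal.coe_le_coe_iff.2 h)

theorem measurable_law_Iio : Measurable fun t : ℝ => M.law.real (Set.Iio t) :=
  Monotone.measurable fun _ _ h => measureReal_mono (Set.Iio_subset_Iio h)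

theorem measurableSet_quantileCell (η : ℝ) (k : ℕ) : MeasurableSet (M.quantileCell η k) :=
  (measurableSet_le measurable_const M.measurable_cdf_coe).inter
    (measurableSet_lt M.measurable_law_Iio measurable_const)

/-- The cell tests the cdf at `t` from below and its left limit from above, so it keeps any atom
straddling a level. The two excluded sets then have mass at most `k η` and `1 - (k + 2) η`. -/
theorem le_law_quantileCell {η : ℝ} (hη : 0 ≤ η) {k : ℕ} (hk : (k + 2) * η ≤ 1) :
    2 * η ≤ M.law.real (M.quantileCell η k) := by
  have h1 : M.law.real {t : ℝ | M.cdf t < k * η} ≤ k * η := by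
    refine ENNReal.toReal_le_of_le_ofReal (by positivity)
      (measure_le_of_forall_measure_inter_Iic_le fun t ht => ?_)
    rw [← ofReal_measureReal]
    refine ENNReal.ofReal_le_ofReal (le_trans (measureReal_mono fun r hr => ?_) (le_of_lt ht))
    exact EReal.coe_le_coe_iff.2 hr.2
  have h2 : M.law.real {t : ℝ | (k + 2) * η ≤ M.law.real (Set.Iio t)} ≤ 1 - (k + 2) * η := by
    refine ENNReal.toReal_le_of_le_ofReal (by linarith)
      (measure_le_of_forall_measure_inter_Ici_le fun t ht => ?_)
    rw [← ofReal_measureReal]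
    refine ENNReal.ofReal_le_ofReal (le_trans (measureReal_mono Set.inter_subset_right) ?_)
    have h3 : M.law.real (Set.Iio t)ᶜ = 1 - M.law.real (Set.Iio t) :=
      probReal_compl_eq_one_sub measurableSet_Iio
    rw [Set.compl_Iio] at h3
    have h4 : (k + 2) * η ≤ M.law.real (Set.Iio t) := ht
    linarith
  have h3 : (Set.univ : Set ℝ) ⊆ {t : ℝ | M.cdf t < k * η} ∪ M.quantileCell η k ∪
      {t : ℝ | (k + 2) * η ≤ M.law.real (Set.Iio t)} := by
    intro t _
    by_cases h4 : M.cdf t < k * η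
    · exact Or.inl (Or.inl h4)
    by_cases h5 : (k + 2) * η ≤ M.law.real (Set.Iio t)
    · exact Or.inr h5
    · exact Or.inl (Or.inr ⟨not_lt.1 h4, not_le.1 h5⟩)
  have h4 := measureReal_mono (μ := M.law) h3
  have h5 := measureReal_union_le (μ := M.law) ({t : ℝ | M.cdf t < k * η} ∪ M.quantileCell η k)
    {t : ℝ | (k + 2) * η ≤ M.law.real (Set.Iio t)}
  have h6 := measureReal_union_le (μ := M.law) {t : ℝ | M.cdf t < k * η} (M.quantileCell η k)
  rw [probReal_univ] at h4
  linarith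

/-- The cell starts at the first multiple of `l / 4` above `cdf a` and ends at most three steps
above `cdf a`, while the segment has mass more than four. Only finitely many cells need enough
observations for all segments to have them. -/
theorem exists_quantileCell_subset {l : ℝ} (hl : 0 < l) {a b : EReal} (hab : a < b)
    (hd : l < M.d a b) :
    ∃ k : ℕ, (k + 2) * (l / 4) ≤ 1 ∧ M.quantileCell (l / 4) k ⊆ segment a b := by
  rw [d_of_le _ hab.le] at hd
  have hη : 0 < l / 4 := by positivity
  have ha := M.cdf_nonneg a
  have hb := M.cdf_le_one b
  have h1 := Nat.floor_le (div_nonneg ha hη.le)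
  have h2 := Nat.lt_floor_add_one (M.cdf a / (l / 4))
  rw [le_div_iff₀ hη] at h1
  rw [div_lt_iff₀ hη] at h2
  refine ⟨⌊M.cdf a / (l / 4)⌋₊ + 1, ?_, ?_⟩
  · push_cast; linarith
  · rintro t ⟨h3, h4⟩
    push_cast at h3 h4
    refine ⟨not_le.1 fun h => ?_, not_lt.1 fun h => ?_⟩
    · have := M.cdf_mono h; linarith
    · have : M.cdf b ≤ M.law.real (Set.Iio t) :=
        measureReal_mono fun r hr => EReal.coe_lt_coe_iff.1 (lt_of_le_of_lt hr h)
      linarith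

end Model

/-! ### Blocks of observations and averages over them. -/

section Blocks

/-- The indices of the observations between the `m`-th and the `m'`-th one. -/
noncomputable def block {n : ℕ} (w : Fin n → ℝ) (m : Fin n × Fin n) : Finset (Fin n) :=
  {i | w m.1 ≤ w i ∧ w i ≤ w m.2}

/-- The block runs from the smallest to the largest observation in the segment. This reduces an
uncountable family of segments to `n ^ 2` index sets. -/
theorem exists_block_eq {n : ℕ} (w : Fin n → ℝ) {a b : EReal}
    (h : ∃ i, w i ∈ segment a b) : ∃ m, ∀ i, i ∈ block w m ↔ w i ∈ segment a b := by
  classical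
  obtain ⟨i₀, hi₀⟩ := h
  let A : Finset (Fin n) := {i | w i ∈ segment a b}
  have hA : A.Nonempty := ⟨i₀, by simpa [A] using hi₀⟩
  obtain ⟨m, hm, hmin⟩ := A.exists_min_image w hA
  obtain ⟨m', hm', hmax⟩ := A.exists_max_image w hA
  simp only [A, Finset.mem_filter, Finset.mem_univ, true_and] at hm hm' hmin hmax
  refine ⟨(m, m'), fun i => ?_⟩
  simp only [block, Finset.mem_filter, Finset.mem_univ, true_and]
  refine ⟨fun hi => ?_, fun hi => ⟨hmin i hi, hmax i hi⟩⟩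
  exact ⟨hm.1.trans_le (EReal.coe_le_coe_iff.2 hi.1), (EReal.coe_le_coe_iff.2 hi.2).trans hm'.2⟩

variable {E ι : Type*} [NormedAddCommGroup E] [InnerProductSpace ℝ E]

/-- The average of a family of vectors over a finite set of indices. -/
noncomputable def average (A : Finset ι) (g : ι → E) : E := (A.card : ℝ)⁻¹ • ∑ i ∈ A, g i

theorem sum_sub_average (A : Finset ι) (g : ι → E) : ∑ i ∈ A, (g i - average A g) = 0 := by
  rcases A.eq_empty_or_nonempty with rfl | hA
  · simp
  have : (A.card : ℝ) ≠ 0 := by exact_mod_cast hA.card_pos.ne'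
  rw [Finset.sum_sub_distrib, Finset.sum_const, average, ← Nat.cast_smul_eq_nsmul ℝ, smul_smul,
    mul_inv_cancel₀ this, one_smul, sub_self]

theorem sum_norm_sub_average_sq_le (A : Finset ι) (g : ι → E) (c : E) :
    ∑ i ∈ A, ‖g i - average A g‖ ^ 2 ≤ ∑ i ∈ A, ‖g i - c‖ ^ 2 := by
  have h : ∀ i, ‖g i - c‖ ^ 2 = ‖g i - average A g‖ ^ 2 +
      2 * inner ℝ (g i - average A g) (average A g - c) + ‖average A g - c‖ ^ 2 := by
    intro i
    rw [← norm_add_sq_real, sub_add_sub_cancel]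
  simp only [h]
  rw [Finset.sum_add_distrib, Finset.sum_add_distrib, ← Finset.mul_sum, ← sum_inner,
    sum_sub_average, inner_zero_left, mul_zero, add_zero]
  exact le_add_of_nonneg_right (Finset.sum_nonneg fun _ _ => sq_nonneg _)

theorem card_mul_norm_average_sub_le {A : Finset ι} (hA : A.Nonempty) (g : ι → E) (c : E) :
    A.card * ‖average A g - c‖ ≤ ∑ i ∈ A, ‖g i - c‖ := by
  have h0 : (A.card : ℝ) ≠ 0 := by exact_mod_cast hA.card_pos.ne'
  have h : ∑ i ∈ A, (g i - c) = (A.card : ℝ) • (average A g - c) := by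
    rw [Finset.sum_sub_distrib, Finset.sum_const, smul_sub, average, smul_smul, mul_inv_cancel₀ h0,
      one_smul, Nat.cast_smul_eq_nsmul]
  calc A.card * ‖average A g - c‖ = ‖∑ i ∈ A, (g i - c)‖ := by
        rw [h, norm_smul, Real.norm_natCast]
    _ ≤ _ := norm_sum_le _ _

theorem norm_average_sub_le_of_forall {A : Finset ι} (hA : A.Nonempty) (g : ι → E) (c : E) {H : ℝ}
    (hg : ∀ i ∈ A, ‖g i - c‖ ≤ H) : ‖average A g - c‖ ≤ H := by
  have h0 : (0 : ℝ) < A.card := by exact_mod_cast hA.card_pos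
  have h1 := (card_mul_norm_average_sub_le hA g c).trans (Finset.sum_le_card_nsmul A _ H hg)
  rw [nsmul_eq_mul] at h1
  exact le_of_mul_le_mul_left h1 h0

end Blocks

/-! ### Balancing the sample size, the jumps and the neighbourhood size. -/

section Scales

theorem le_mul_of_sqrt_div_le {n L r : ℝ} (hn : 0 < n) (hL : 0 ≤ L) (hLn : L ≤ n)
    (hr : √(L / n) ≤ r) : L ≤ n * r := by
  have h1 : L / n ≤ √(L / n) := by
    refine Real.le_sqrt_of_sq_le ?_
    have h2 : L / n ≤ 1 := (div_le_one hn).2 hLn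
    have h3 : 0 ≤ L / n := by positivity
    nlinarith
  have := h1.trans hr
  rw [div_le_iff₀ hn] at this
  linarith

/-- A scale `Q` that dominates the coefficient differences and balances Bernstein's inequality. -/
theorem exists_scale {n L l u ξ r csep c' : ℝ} (hn : 0 < n) (hL : 0 < L) (hl : 0 < l) (hl1 : l ≤ 1)
    (hLn : L ≤ n * l ^ 2) (hu : 0 ≤ u) (hξ : 0 ≤ ξ) (hcsep : 0 < csep) (hc' : 0 < c')
    (hr1 : √(L / n) ≤ r) (hr2 : ξ * u ≤ r) (hr3 : ξ * (L / n) ≤ c' * r) :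
    ∃ Q, 0 < Q ∧ (1 + u / (csep * l)) * ξ ≤ Q ∧
      Q * L ≤ (10 * (1 + 1 / csep) * (1 + c') + 1) * (n * r) ∧
      ∀ O : ℝ, 0 ≤ O → O ≤ n → O ≤ 4 * n * u + 10 * L → O * ((1 + u / (csep * l)) * ξ) ^ 2 ≤
        Q * ((10 * (1 + 1 / csep) * (1 + c') + 1) * (n * r)) := by
  have hl2 : l ^ 2 ≤ 1 := pow_le_one₀ hl.le hl1
  have hLn1 : L ≤ n := hLn.trans (mul_le_of_le_one_right hn.le hl2)
  have hLr := le_mul_of_sqrt_div_le hn hL.le hLn1 hr1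
  have hr0 : 0 ≤ r := (Real.sqrt_nonneg _).trans hr1
  have hnr : 0 ≤ n * r := by positivity
  set h := 1 + 1 / csep with hh
  have h1 : 1 ≤ h := by rw [hh]; have : 0 ≤ 1 / csep := by positivity
                        linarith
  have h0 : 0 < h := by linarith
  set K := 10 * h * (1 + c') + 1 with hK
  have hK0 : 0 ≤ K := by positivity
  have hH0 : 0 ≤ (1 + u / (csep * l)) * ξ := by positivity
  have hξL : ξ * L ≤ c' * (n * r) := by
    have := mul_le_mul_of_nonneg_left hr3 hn.le
    have e : n * (ξ * (L / n)) = ξ * L := by field_simp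
    rw [e] at this; linarith
  have hξu : ξ * (n * u) ≤ n * r := by
    have := mul_le_mul_of_nonneg_left hr2 hn.le
    linarith
  -- For `u ≤ l` the coefficient error is of order `ξ`, and the count of foreign observations is the
  -- useful bound. For `u ≥ l` the error may be of order `ξ u / l`, and the trivial count `n`
  -- suffices.
  rcases le_total u l with hul | hul
  · have hH : (1 + u / (csep * l)) * ξ ≤ h * ξ := by
      refine mul_le_mul_of_nonneg_right ?_ hξ
      rw [hh]
      have : u / (csep * l) ≤ 1 / csep := by
        rw [div_le_div_iff₀ (by positivity) hcsep]
        have := mul_le_mul_of_nonneg_left hul hcsep.le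
        linarith
      linarith
    have hcorr : 0 ≤ h * ξ * (n * u / L) := by positivity
    -- The factor `1 + n u / L` gives `Q * L` the size `ξ L + ξ n u`, both parts of order `n r`. The
    -- summand `1` keeps `Q` positive when `ξ = 0` and costs `L ≤ n r`.
    refine ⟨h * ξ * (1 + n * u / L) + 1, by positivity, ?_, ?_, ?_⟩
    · linarith
    · have e : (h * ξ * (1 + n * u / L) + 1) * L = h * (ξ * L + ξ * (n * u)) + L := by
        field_simp
      rw [e]
      have h2 := mul_le_mul_of_nonneg_left (add_le_add hξL hξu) h0.le
      have h3 : 0 ≤ h * (1 + c') * (n * r) := by positivity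
      rw [hK]
      linarith
    · intro O _ _ hO
      have hO' : O ≤ 10 * (L + n * u) := by
        have : 0 ≤ n * u := by positivity
        linarith
      calc O * ((1 + u / (csep * l)) * ξ) ^ 2 ≤ 10 * (L + n * u) * (h * ξ) ^ 2 :=
            mul_le_mul hO' (pow_le_pow_left₀ hH0 hH 2) (sq_nonneg _) (by positivity)
        _ = h * ξ * (1 + n * u / L) * (10 * h * (ξ * L)) := by field_simp
        _ ≤ h * ξ * (1 + n * u / L) * (10 * h * (c' * (n * r))) := by gcongr
        _ ≤ (h * ξ * (1 + n * u / L) + 1) * (K * (n * r)) := by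
            refine mul_le_mul (by linarith) ?_ (by positivity) (by positivity)
            rw [hK]
            have : 0 ≤ (10 * h + 1) * (n * r) := by positivity
            linarith
  · have hH : (1 + u / (csep * l)) * ξ ≤ h * ξ * u / l := by
      have e : h * ξ * u / l = (u / l + u / (csep * l)) * ξ := by rw [hh]; field_simp
      rw [e]
      refine mul_le_mul_of_nonneg_right ?_ hξ
      have : 1 ≤ u / l := (one_le_div hl).2 hul
      linarith
    have hHQ : h * ξ * u / l ≤ h * ξ * u / l ^ 2 := by
      refine div_le_div_of_nonneg_left (by positivity) (by positivity) ?_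
      nlinarith
    -- The divisor `l ^ 2` is affordable because `L / l ^ 2 ≤ n`.
    refine ⟨h * ξ * u / l ^ 2 + 1, by positivity, by linarith, ?_, ?_⟩
    · have e : (h * ξ * u / l ^ 2 + 1) * L = h * (ξ * u) * (L / l ^ 2) + L := by field_simp
      have h2 : L / l ^ 2 ≤ n := by rw [div_le_iff₀ (by positivity)]; exact hLn
      have h3 : h * (ξ * u) * (L / l ^ 2) ≤ h * r * n :=
        mul_le_mul (mul_le_mul_of_nonneg_left hr2 h0.le) h2 (by positivity) (by positivity)
      rw [e, hK]
      have h4 : 0 ≤ (9 * h + 10 * h * c') * (n * r) := by positivity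
      linarith
    · intro O hO0 hOn _
      calc O * ((1 + u / (csep * l)) * ξ) ^ 2 ≤ n * (h * ξ * u / l) ^ 2 :=
            mul_le_mul hOn (pow_le_pow_left₀ hH0 hH 2) (sq_nonneg _) hn.le
        _ = h * ξ * u / l ^ 2 * (h * (ξ * (n * u))) := by field_simp
        _ ≤ h * ξ * u / l ^ 2 * (h * (n * r)) := by gcongr
        _ ≤ (h * ξ * u / l ^ 2 + 1) * (K * (n * r)) := by
            refine mul_le_mul (by linarith) ?_ (by positivity) (by positivity)
            rw [hK]
            have : 0 ≤ (9 * h + 10 * h * c' + 1) * (n * r) := by positivity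
            linarith

/-- Divided by the block size `a`, this bounds the distance from the average coefficient to the
target. For `u ≤ l` it uses `a ≥ n l / 8`; for `u ≥ l` it uses only `O ≤ a`. -/
theorem mul_le_card_mul_rate {n L l u ξ r csep c' O a : ℝ} (hn : 0 < n) (hL : 0 < L) (hl : 0 < l)
    (hu : 0 ≤ u) (hξ : 0 ≤ ξ) (hcsep : 0 < csep) (hc' : 0 < c') (hr : 0 ≤ r)
    (hr2 : ξ * u ≤ r) (hr3 : ξ * (L / n) ≤ c' * r) (hO0 : 0 ≤ O) (hOa : O ≤ a)
    (hO : O ≤ 4 * n * u + 10 * L) (ha : n * l / 8 ≤ a) :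
    O * ((1 + u / (csep * l)) * ξ) ≤ a * (80 * (1 + 1 / csep) * (1 + c') * r / l) := by
  set h := 1 + 1 / csep with hh
  have h0 : 0 < h := by positivity
  have ha0 : 0 ≤ a := le_trans (by positivity) ha
  have hξL : ξ * L ≤ c' * (n * r) := by
    have := mul_le_mul_of_nonneg_left hr3 hn.le
    have e : n * (ξ * (L / n)) = ξ * L := by field_simp
    rw [e] at this; linarith
  have hξu : ξ * (n * u) ≤ n * r := by
    have := mul_le_mul_of_nonneg_left hr2 hn.le
    linarith
  rcases le_total u l with hul | hul
  · have hH : (1 + u / (csep * l)) * ξ ≤ h * ξ := by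
      refine mul_le_mul_of_nonneg_right ?_ hξ
      rw [hh]
      have : u / (csep * l) ≤ 1 / csep := by
        rw [div_le_div_iff₀ (by positivity) hcsep]
        have := mul_le_mul_of_nonneg_left hul hcsep.le
        linarith
      linarith
    calc O * ((1 + u / (csep * l)) * ξ) ≤ (10 * (n * u) + 10 * L) * (h * ξ) := by
          refine mul_le_mul (hO.trans ?_) hH (by positivity) (by positivity)
          have : 0 ≤ n * u := by positivity
          linarith
      _ = 10 * h * (ξ * (n * u) + ξ * L) := by ring
      _ ≤ 10 * h * (n * r + c' * (n * r)) := by gcongr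
      _ = n * l / 8 * (80 * h * (1 + c') * r / l) := by field_simp; ring
      _ ≤ _ := by gcongr
  · have hH : (1 + u / (csep * l)) * ξ ≤ h * (ξ * u) / l := by
      have e : h * (ξ * u) / l = (u / l + u / (csep * l)) * ξ := by rw [hh]; field_simp
      rw [e]
      refine mul_le_mul_of_nonneg_right ?_ hξ
      have : 1 ≤ u / l := (one_le_div hl).2 hul
      linarith
    refine mul_le_mul hOa (hH.trans ?_) (by positivity) ha0
    refine div_le_div_of_nonneg_right ?_ hl.le
    have h2 := mul_le_mul_of_nonneg_left hr2 h0.le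
    have h3 : 0 ≤ (79 + 80 * c') * (h * r) := by positivity
    linarith

end Scales

/-! ### Deterministic consequences of a regular sample. -/

namespace Model

variable {Ω : Type*} [MeasurableSpace Ω] {n p N : ℕ} (M : Model Ω n p N)

/-- The counting properties of a sample `w` of change inducing variables: few observations fall
outside the `j`-th regime next to it, and enough of them between quantiles. -/
structure RegularSample (l u L : ℝ) (j : Fin (N + 1)) (w : Fin n → ℝ) : Prop where
  left : ∑ i, (M.leftExcess u j).indicator (fun _ => (1 : ℝ)) (w i) ≤ 2 * n * u + 5 * L
  right : ∑ i, (M.rightExcess u j).indicator (fun _ => (1 : ℝ)) (w i) ≤ 2 * n * u + 5 * L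
  cell : ∀ k : ℕ, (k + 2) * (l / 4) ≤ 1 →
    n * l / 8 ≤ ∑ i, (M.quantileCell (l / 4) k).indicator (fun _ => (1 : ℝ)) (w i)

variable {M}

theorem RegularSample.exists_block {l u L csep : ℝ} {j : Fin (N + 1)} {w : Fin n → ℝ}
    (hw : M.RegularSample l u L j w) (hn : 0 < n) (hl : 0 < l) (hu : 0 ≤ u) (hcsep : 0 < csep)
    (hsep : ∀ j : Fin N, csep * l ≤ M.d (M.tau j) (M.tau (j + 1)))
    {q : EReal × EReal} (hq : q ∈ M.segments l u j) :
    ∃ m, (∀ i, i ∈ block w m ↔ w i ∈ segment q.1 q.2) ∧ n * l / 8 ≤ (block w m).card ∧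
      (∀ i ∈ block w m, ‖M.coefAt (w i) - M.coef j‖ ≤ (1 + u / (csep * l)) * M.jumpMax) ∧
      ∃ O : ℝ, 0 ≤ O ∧ O ≤ (block w m).card ∧ O ≤ 4 * n * u + 10 * L ∧
        ∑ i ∈ block w m, ‖M.coefAt (w i) - M.coef j‖ ≤ O * ((1 + u / (csep * l)) * M.jumpMax) ∧
        ∑ i ∈ block w m, ‖M.coefAt (w i) - M.coef j‖ ^ 2 ≤
          O * ((1 + u / (csep * l)) * M.jumpMax) ^ 2 := by
  classical
  obtain ⟨k, hk1, hk2⟩ := M.exists_quantileCell_subset hl hq.1 hq.2.1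
  have hcount : ∀ S : Set ℝ, ∑ i, S.indicator (fun _ => (1 : ℝ)) (w i) =
      (Finset.univ.filter fun i => w i ∈ S).card := by
    intro S
    simp [Set.indicator_apply]
  have hcell := hw.cell k hk1
  rw [hcount] at hcell
  have hne : ∃ i, w i ∈ segment q.1 q.2 := by
    have : 0 < ((Finset.univ.filter fun i => w i ∈ M.quantileCell (l / 4) k).card : ℝ) :=
      lt_of_lt_of_le (by positivity) hcell
    obtain ⟨i, hi⟩ := Finset.card_pos.1 (by exact_mod_cast this)
    exact ⟨i, hk2 (Finset.mem_filter.1 hi).2⟩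
  obtain ⟨m, hm⟩ := exists_block_eq w hne
  have hnorm : ∀ i ∈ block w m,
      ‖M.coefAt (w i) - M.coef j‖ ≤ (1 + u / (csep * l)) * M.jumpMax := fun i hi =>
    (M.norm_coefAt_sub_le hl hcsep hsep hq ((hm i).1 hi)).2 hu
  set H := (1 + u / (csep * l)) * M.jumpMax with hH
  -- Only indices in `B` can have a coefficient vector other than `coef j`; the number `O` is its
  -- cardinality.
  let B : Finset (Fin n) :=
    (block w m).filter fun i => w i ∈ M.leftExcess u j ∨ w i ∈ M.rightExcess u j
  have hzero : ∀ i ∈ block w m, i ∉ B → ‖M.coefAt (w i) - M.coef j‖ = 0 := by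
    intro i hi hiB
    have h1 : ¬(w i ∈ M.leftExcess u j ∨ w i ∈ M.rightExcess u j) := fun h =>
      hiB (Finset.mem_filter.2 ⟨hi, h⟩)
    push Not at h1
    rw [(M.norm_coefAt_sub_le hl hcsep hsep hq ((hm i).1 hi)).1 h1.1 h1.2, sub_self, norm_zero]
  refine ⟨m, hm, hcell.trans ?_, hnorm, B.card, by positivity, ?_, ?_, ?_, ?_⟩
  · exact_mod_cast Finset.card_le_card fun i hi => (hm i).2 (hk2 (Finset.mem_filter.1 hi).2)
  · exact_mod_cast Finset.card_filter_le _ _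
  · have h1 : B.card ≤ (Finset.univ.filter fun i => w i ∈ M.leftExcess u j).card +
        (Finset.univ.filter fun i => w i ∈ M.rightExcess u j).card := by
      refine (Finset.card_le_card (fun i hi => ?_)).trans (Finset.card_union_le _ _)
      have := (Finset.mem_filter.1 hi).2
      simpa using this
    have h2 := hw.left
    have h3 := hw.right
    rw [hcount] at h2 h3
    have h4 : (B.card : ℝ) ≤ (Finset.univ.filter fun i => w i ∈ M.leftExcess u j).card +
        (Finset.univ.filter fun i => w i ∈ M.rightExcess u j).card := by exact_mod_cast h1
    linarith
  · rw [← Finset.sum_subset (Finset.filter_subset _ _) hzero, ← nsmul_eq_mul]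
    exact Finset.sum_le_card_nsmul _ _ _ fun i hi => hnorm i (Finset.mem_filter.1 hi).1
  · rw [← Finset.sum_subset (Finset.filter_subset _ _)
      (fun i hi hiB => by rw [hzero i hi hiB]; simp), ← nsmul_eq_mul]
    exact Finset.sum_le_card_nsmul _ _ _ fun i hi =>
      pow_le_pow_left₀ (norm_nonneg _) (hnorm i (Finset.mem_filter.1 hi).1) 2

end Model

/-! ### Regular designs and the error bound they imply. -/

namespace Model

variable {Ω : Type*} [MeasurableSpace Ω] {n p N : ℕ} (M : Model Ω n p N)

/-- The deviation of the coefficients from their average over a block of observations. -/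
noncomputable def deviation (w : Fin n → ℝ) (A : Finset (Fin n)) (i : Fin n) :
    EuclideanSpace ℝ (Fin p) :=
  M.coefAt (w i) - average A fun i => M.coefAt (w i)

/-- The properties of the predictors and the errors on all blocks of observations: a sparse
eigenvalue bound, a bound on the diagonal of the Gram matrix, and bounds on the two parts of the
score at the average coefficient. -/
structure RegularDesign (c D b Tnoise Q V Tbias : ℝ) (k : ℕ)
    (x : Fin n → EuclideanSpace ℝ (Fin p)) (w e : Fin n → ℝ) : Prop where
  sparse : ∀ m (f : Fin k → Fin p × Bool), b ≤ (block w m).card →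
    c * (block w m).card * ‖∑ i, signedBasis p (f i)‖ ^ 2 ≤
      ∑ i ∈ block w m, inner ℝ (x i) (∑ i, signedBasis p (f i)) ^ 2
  diag : ∀ m l, b ≤ (block w m).card → ∑ i ∈ block w m, x i l ^ 2 ≤ D * (block w m).card
  noise : ∀ m l, |∑ i ∈ block w m, e i * x i l| ≤ Tnoise
  bias : ∀ m l, (∀ i ∈ block w m, ‖M.deviation w (block w m) i‖ ≤ 2 * Q) →
    ∑ i ∈ block w m, ‖M.deviation w (block w m) i‖ ^ 2 ≤ Q * V →
    |∑ i ∈ block w m, inner ℝ (x i) (M.deviation w (block w m) i) * x i l| ≤ Tbias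

theorem coefAt_eq_zero {k : Fin p} (hk : k ∉ M.support) (t : ℝ) : M.coefAt t k = 0 := by
  obtain ⟨j, -, hj⟩ := M.exists_mem_segment t
  rw [hj]
  by_contra h
  exact hk ⟨j, h⟩

theorem average_coefAt_eq_zero {k : Fin p} (hk : k ∉ M.support) (w : Fin n → ℝ)
    (A : Finset (Fin n)) : average A (fun i => M.coefAt (w i)) k = 0 := by
  simp only [average, PiLp.smul_apply, WithLp.ofLp_sum, Finset.sum_apply, smul_eq_mul]
  rw [Finset.sum_eq_zero fun i _ => M.coefAt_eq_zero hk (w i), mul_zero]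

theorem segLoss_eq {a b : EReal} {ω : Ω} {A : Finset (Fin n)}
    (hA : ∀ i, i ∈ A ↔ M.w i ω ∈ segment a b) (γ : EuclideanSpace ℝ (Fin p)) :
    M.segLoss a b ω γ = ∑ i ∈ A, (M.y i ω - inner ℝ (M.x i ω) γ) ^ 2 := by
  rw [segLoss, ← Finset.sum_subset (Finset.subset_univ A)]
  · exact Finset.sum_congr rfl fun i hi => Set.indicator_of_mem ((hA i).1 hi) _
  · exact fun i _ hi => Set.indicator_of_notMem (fun h => hi ((hA i).2 h)) _

theorem l1norm_le_of_support {s : ℕ} (hs : M.support.ncard ≤ s) {v : EuclideanSpace ℝ (Fin p)}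
    (hv : ∀ k ∉ M.support, v k = 0) : l1norm v ≤ √(s : ℝ) * ‖v‖ := by
  classical
  have h := sum_abs_le_sqrt_card_mul_norm M.support.toFinset v
  rw [← Set.ncard_eq_toFinset_card'] at h
  rw [l1norm, ← Finset.sum_subset (Finset.subset_univ M.support.toFinset)]
  · refine h.trans (mul_le_mul_of_nonneg_right (Real.sqrt_le_sqrt ?_) (norm_nonneg _))
    exact_mod_cast hs
  · intro k _ hk
    rw [hv k (by simpa using hk), abs_zero]

/-- On the cone the transfer principle loses at most `8 σ² * 16 s / (k - 1)` per observation. The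
lower bound on `k` makes this at most `κ / 4`, half of the sparse constant. -/
theorem restricted_eigenvalue {ι : Type*} (A : Finset ι) (x : ι → EuclideanSpace ℝ (Fin p))
    {κ σ b s : ℝ} (hκ : 0 < κ) {k : ℕ} (hk : 512 * σ ^ 2 * s / κ + 1 < k)
    (hs : 0 ≤ s) (hb : b ≤ A.card)
    (hsparse : ∀ f : Fin k → Fin p × Bool, κ / 2 * A.card * ‖∑ i, signedBasis p (f i)‖ ^ 2 ≤
      ∑ i ∈ A, inner ℝ (x i) (∑ i, signedBasis p (f i)) ^ 2)
    (hdiag : ∀ l, ∑ i ∈ A, x i l ^ 2 ≤ 8 * σ ^ 2 * A.card) (v : EuclideanSpace ℝ (Fin p))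
    (hv : l1norm v ^ 2 ≤ 16 * s * ‖v‖ ^ 2) :
    κ / 4 * b * ‖v‖ ^ 2 ≤ ∑ i ∈ A, inner ℝ (x i) v ^ 2 := by
  have h0 : 0 ≤ 512 * σ ^ 2 * s / κ := by positivity
  have hk0 : (0 : ℝ) < k := by linarith
  have h1 := neg_mul_l1norm_sq_le A x (c := κ / 2 * A.card) (by positivity)
    (by exact_mod_cast hk0) hsparse hdiag v
  have h2 : 8 * σ ^ 2 * A.card * l1norm v ^ 2 ≤ 8 * σ ^ 2 * A.card * (16 * s * ‖v‖ ^ 2) :=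
    mul_le_mul_of_nonneg_left hv (by positivity)
  have h3 : 512 * σ ^ 2 * s ≤ κ * (k - 1) := by
    have : 512 * σ ^ 2 * s / κ ≤ k - 1 := by linarith
    rw [div_le_iff₀ hκ] at this
    linarith
  have h4 : 0 ≤ (A.card : ℝ) * ‖v‖ ^ 2 := by positivity
  have h5 := mul_le_mul_of_nonneg_right h3 h4
  have hk1 : (0 : ℝ) < k - 1 := by linarith
  have h6 : 0 ≤ (k - 1) * (∑ i ∈ A, inner ℝ (x i) v ^ 2 - κ / 4 * A.card * ‖v‖ ^ 2) := by
    nlinarith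
  have h7 := nonneg_of_mul_nonneg_right h6 hk1
  have h8 : κ / 4 * b * ‖v‖ ^ 2 ≤ κ / 4 * A.card * ‖v‖ ^ 2 := by gcongr
  linarith

/-- The Lasso error is measured from the block average, whose own distance to `coef j` is of the
same order. The constant `44 = 8 * (5 + 1/2)` collects the bias part of the score and `9` the noise
part; the factor `4` answers the requirement that the score be at most `n lam / 4`. -/
theorem error_le_of_regular {σx σε κ csep c' l u r L Q K : ℝ} {s k : ℕ}
    (hn : 0 < n) (hσx : 0 < σx) (hσε : 0 < σε) (hκ : 0 < κ) (hcsep : 0 < csep) (hc' : 0 < c')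
    (hl : 0 < l) (hu : 0 ≤ u) (hL : 0 < L) (hr : 0 < r)
    (hr1 : √(L / n) ≤ r) (hr2 : M.jumpMax * u ≤ r) (hr3 : M.jumpMax * (L / n) ≤ c' * r)
    (hs : M.support.ncard ≤ s) (hs1 : 1 ≤ s)
    (hsep : ∀ j : Fin N, csep * l ≤ M.d (M.tau j) (M.tau (j + 1)))
    (hk : 512 * σx ^ 2 * s / κ + 1 < k)
    (hQ1 : (1 + u / (csep * l)) * M.jumpMax ≤ Q) (hK : 0 < K) (hQ2 : Q * L ≤ K * (n * r))
    (hQ3 : ∀ O : ℝ, 0 ≤ O → O ≤ n → O ≤ 4 * n * u + 10 * L →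
      O * ((1 + u / (csep * l)) * M.jumpMax) ^ 2 ≤ Q * (K * (n * r)))
    {j : Fin (N + 1)} {ω : Ω} (hw : M.RegularSample l u L j fun i => M.w i ω)
    (hx : M.RegularDesign (κ / 2) (8 * σx ^ 2) (n * l / 8) (9 * σx * σε * (n * √(L / n))) Q
      (K * (n * r)) (8 * σx ^ 2 * (Q * (5 * L) + K * (n * r) / 2)) k
      (fun i => M.x i ω) (fun i => M.w i ω) fun i => M.noise i ω)
    {q : EReal × EReal} (hq : q ∈ M.segments l u j) {α : EuclideanSpace ℝ (Fin p)}
    (hα : M.IsLasso (4 * (44 * σx ^ 2 * K + 9 * σx * σε) * r) q.1 q.2 ω α) :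
    l1norm (α - M.coef j) ≤ (192 * (4 * (44 * σx ^ 2 * K + 9 * σx * σε)) / κ +
        80 * (1 + 1 / csep) * (1 + c')) * s * r / l ∧
      ‖α - M.coef j‖ ≤ (192 * (4 * (44 * σx ^ 2 * K + 9 * σx * σε)) / κ +
        80 * (1 + 1 / csep) * (1 + c')) * √(s : ℝ) * r / l := by
  classical
  have hn' : (0 : ℝ) < n := by exact_mod_cast hn
  obtain ⟨m, hm, hcard, hnorm, O, hO0, hOc, hO, hsum1, hsum2⟩ :=
    hw.exists_block hn hl hu hcsep hsep hq
  set w : Fin n → ℝ := fun i => M.w i ω with hwdef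
  set A := block w m with hA
  set H := (1 + u / (csep * l)) * M.jumpMax with hH
  have hA0 : (0 : ℝ) < A.card := lt_of_lt_of_le (by positivity) hcard
  have hAne : A.Nonempty := Finset.card_pos.1 (by exact_mod_cast hA0)
  set g : Fin n → EuclideanSpace ℝ (Fin p) := fun i => M.coefAt (w i) with hg
  set γ := average A g with hγ
  set clam := 4 * (44 * σx ^ 2 * K + 9 * σx * σε) with hclam
  set K₁ := 80 * (1 + 1 / csep) * (1 + c') with hK₁
  have hclam0 : 0 < clam := by positivity
  have hK₁0 : 0 < K₁ := by positivity
  have hγH : ‖γ - M.coef j‖ ≤ H := norm_average_sub_le_of_forall hAne g _ hnorm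
  have hγerr : ‖γ - M.coef j‖ ≤ K₁ * r / l := by
    have h1 := (card_mul_norm_average_sub_le hAne g (M.coef j)).trans hsum1
    exact le_of_mul_le_mul_left (h1.trans (mul_le_card_mul_rate hn' hL hl hu M.jumpMax_nonneg
      hcsep hc' hr.le hr2 hr3 hO0 hOc hO hcard)) hA0
  -- Passing through `coef j` doubles the bound on individual deviations, whereas the sum of squares
  -- does not grow, because the average minimises it.
  have hbias := fun k => hx.bias m k
    (fun i hi => by
      have h1 := norm_sub_le_norm_sub_add_norm_sub (g i) (M.coef j) γ
      rw [norm_sub_rev (M.coef j)] at h1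
      have h2 := hnorm i hi
      change ‖g i - γ‖ ≤ 2 * Q
      linarith)
    ((sum_norm_sub_average_sq_le A g (M.coef j)).trans (hsum2.trans (hQ3 O hO0
      (hOc.trans (by exact_mod_cast (Finset.card_le_univ A).trans_eq (by simp))) hO)))
  have hscore : ∀ k, |∑ i ∈ A, (M.y i ω - inner ℝ (M.x i ω) γ) * M.x i ω k| ≤
      n * (clam * r) / 4 := by
    intro k
    have e : ∑ i ∈ A, (M.y i ω - inner ℝ (M.x i ω) γ) * M.x i ω k =
        ∑ i ∈ A, inner ℝ (M.x i ω) (M.deviation w A i) * M.x i ω k +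
          ∑ i ∈ A, M.noise i ω * M.x i ω k := by
      rw [← Finset.sum_add_distrib]
      refine Finset.sum_congr rfl fun i _ => ?_
      rw [M.y_eq, deviation, inner_sub_right]
      ring
    rw [e]
    refine (abs_add_le _ _).trans ((add_le_add (hbias k) (hx.noise m k)).trans ?_)
    have h1 : 8 * σx ^ 2 * (Q * (5 * L) + K * (n * r) / 2) ≤
        8 * σx ^ 2 * (5 * (K * (n * r)) + K * (n * r) / 2) :=
      mul_le_mul_of_nonneg_left (by linarith) (by positivity)
    have h2 : 9 * σx * σε * (n * √(L / n)) ≤ 9 * σx * σε * (n * r) := by gcongr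
    rw [hclam]
    linarith
  have hre : ∀ v, l1norm v ^ 2 ≤ 16 * (s : ℝ) * ‖v‖ ^ 2 →
      κ * l / 32 * n * ‖v‖ ^ 2 ≤ ∑ i ∈ A, inner ℝ (M.x i ω) v ^ 2 := by
    intro v hv
    have h := restricted_eigenvalue A (fun i => M.x i ω) hκ hk (by positivity) hcard
      (fun f => hx.sparse m f hcard) (fun l => hx.diag m l hcard) v hv
    refine le_trans (le_of_eq ?_) h
    ring
  have hopt := hα γ
  rw [M.segLoss_eq hm, M.segLoss_eq hm] at hopt
  obtain ⟨h2, h1⟩ := lasso_error_le A (fun i => M.x i ω) (fun i => M.y i ω) hn'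
    (by positivity : 0 < κ * l / 32) (by positivity) M.support.toFinset (s := (s : ℝ))
    (by rw [← Set.ncard_eq_toFinset_card']; exact_mod_cast hs) γ α
    (fun k hk => M.average_coefAt_eq_zero (by simpa using hk) w A) hopt hscore hre
  have hs0 : (1 : ℝ) ≤ s := by exact_mod_cast hs1
  have hsq : 1 ≤ √(s : ℝ) := Real.one_le_sqrt.2 hs0
  have hss : √(s : ℝ) * √(s : ℝ) = s := Real.mul_self_sqrt (by positivity)
  have hsplit : α - M.coef j = (α - γ) + (γ - M.coef j) := by abel
  have e2 : 3 / 2 * (clam * r) * √(s : ℝ) / (κ * l / 32) = 48 * clam / κ * √(s : ℝ) * r / l := by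
    field_simp; norm_num
  rw [e2] at h2
  have hrl : 0 ≤ r / l := by positivity
  constructor
  · rw [hsplit]
    refine (l1norm_add_le _ _).trans ?_
    have h3 : l1norm (γ - M.coef j) ≤ √(s : ℝ) * ‖γ - M.coef j‖ := by
      refine M.l1norm_le_of_support hs fun k hk => ?_
      have h4 := M.average_coefAt_eq_zero hk w A
      have h5 : M.coef j k = 0 := by
        by_contra h
        exact hk ⟨j, h⟩
      simp only [PiLp.sub_apply, h5, sub_zero]
      exact h4
    have h4 : √(s : ℝ) * ‖γ - M.coef j‖ ≤ s * (K₁ * r / l) := by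
      refine mul_le_mul ?_ hγerr (norm_nonneg _) (by positivity)
      nlinarith
    have h5 : 4 * √(s : ℝ) * ‖α - γ‖ ≤ 4 * √(s : ℝ) * (48 * clam / κ * √(s : ℝ) * r / l) :=
      mul_le_mul_of_nonneg_left h2 (by positivity)
    have h6 : 4 * √(s : ℝ) * (48 * clam / κ * √(s : ℝ) * r / l) = 192 * clam / κ * s * r / l := by
      calc _ = 192 * clam / κ * (√(s : ℝ) * √(s : ℝ)) * r / l := by ring
        _ = _ := by rw [hss]
    have h7 : (192 * clam / κ + K₁) * s * r / l = 192 * clam / κ * s * r / l + s * (K₁ * r / l) := by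
      ring
    linarith
  · rw [hsplit]
    refine (norm_add_le _ _).trans ?_
    have h3 : K₁ * r / l ≤ √(s : ℝ) * (K₁ * r / l) :=
      le_mul_of_one_le_left (by positivity) hsq
    have h4 : 0 ≤ 144 * clam / κ * √(s : ℝ) * r / l := by positivity
    have h5 : (192 * clam / κ + K₁) * √(s : ℝ) * r / l = 48 * clam / κ * √(s : ℝ) * r / l +
        √(s : ℝ) * (K₁ * r / l) + 144 * clam / κ * √(s : ℝ) * r / l := by ring
    linarith

end Model

/-! ### Union bounds and measurability of events on blocks. -/

theorem measureReal_exists_le {Ω ι : Type*} [MeasurableSpace Ω] {P : Measure Ω} [Fintype ι]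
    {S : ι → Ω → Prop} {δ : ℝ} (h : ∀ i, P.real {ω | S i ω} ≤ δ) :
    P.real {ω | ∃ i, S i ω} ≤ Fintype.card ι * δ := by
  have e : {ω | ∃ i, S i ω} = ⋃ i, {ω | S i ω} := by ext; simp
  rw [e]
  refine (measureReal_iUnion_fintype_le _).trans ?_
  refine (Finset.sum_le_card_nsmul _ _ δ fun i _ => h i).trans_eq ?_
  rw [nsmul_eq_mul, Finset.card_univ]

theorem measureReal_or_le {Ω : Type*} [MeasurableSpace Ω] {P : Measure Ω} {S T : Ω → Prop}
    {a b : ℝ} (hS : P.real {ω | S ω} ≤ a) (hT : P.real {ω | T ω} ≤ b) :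
    P.real {ω | S ω ∨ T ω} ≤ a + b :=
  (measureReal_union_le {ω | S ω} {ω | T ω}).trans (add_le_add hS hT)

theorem measurableSet_and {Z : Type*} [MeasurableSpace Z] {S T : Z → Prop}
    (hS : MeasurableSet {z | S z}) (hT : MeasurableSet {z | T z}) :
    MeasurableSet {z | S z ∧ T z} :=
  hS.inter hT

/-- The block takes finitely many values, so the event splits into pieces on which it is a constant
index set. -/
theorem measurableSet_block {Z : Type*} [MeasurableSpace Z] {n : ℕ} {w : Z → Fin n → ℝ}
    (hw : Measurable w) (m : Fin n × Fin n) {S : Finset (Fin n) → Z → Prop}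
    (hS : ∀ A, MeasurableSet {z | S A z}) : MeasurableSet {z | S (block (w z) m) z} := by
  have e : {z | S (block (w z) m) z} =
      ⋃ A : Finset (Fin n), (⋂ i, {z | i ∈ A ↔ w z m.1 ≤ w z i ∧ w z i ≤ w z m.2}) ∩
        {z | S A z} := by
    ext z
    simp only [Set.mem_ofPred_eq, Set.mem_iUnion, Set.mem_inter_iff, Set.mem_iInter]
    constructor
    · exact fun h => ⟨block (w z) m, fun i => by simp [block], h⟩
    · rintro ⟨A, hA, h⟩
      have : block (w z) m = A := by ext i; simp [block, hA i]
      rwa [this]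
  rw [e]
  refine MeasurableSet.iUnion fun A => (MeasurableSet.iInter fun i => ?_).inter (hS A)
  have hi : ∀ i, Measurable fun z => w z i := fun i => (measurable_pi_apply i).comp hw
  have h1 : MeasurableSet {z | w z m.1 ≤ w z i ∧ w z i ≤ w z m.2} :=
    (measurableSet_le (hi _) (hi _)).inter (measurableSet_le (hi _) (hi _))
  by_cases hA : i ∈ A
  · simpa [hA] using h1
  · have e2 : {z | i ∈ A ↔ w z m.1 ≤ w z i ∧ w z i ≤ w z m.2} =
        {z | w z m.1 ≤ w z i ∧ w z i ≤ w z m.2}ᶜ := by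
      ext z
      simp only [hA, false_iff, Set.mem_ofPred_eq, Set.mem_compl_iff]
    rw [e2]
    exact h1.compl

/-! ### Probability of regular samples and regular designs. -/

namespace Model

variable {Ω : Type*} [MeasurableSpace Ω] {n p N : ℕ} {M : Model Ω n p N} {P : Measure Ω}
  {σx σε : ℝ≥0} {κ φ : ℝ}

theorem DistributionAssumptions.measureReal_not_regularSample_le [IsProbabilityMeasure P]
    (hD : M.DistributionAssumptions P σx σε κ φ) {l u L : ℝ} (hl : 0 < l) (hu : 0 ≤ u)
    (j : Fin (N + 1)) :
    P.real {ω | ¬M.RegularSample l u L j fun i => M.w i ω} ≤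
      2 * Real.exp (-(5 * L)) + (4 / l + 1) * Real.exp (-(n * l / 8)) := by
  have hside : ∀ S : Set ℝ, MeasurableSet S → M.law.real S ≤ u →
      P.real {ω | 2 * n * u + 5 * L ≤ ∑ i, S.indicator (fun _ => (1 : ℝ)) (M.w i ω)} ≤
        Real.exp (-(5 * L)) := by
    intro S hS hSu
    have h := measureReal_le_card_le hD.indep_w M.measurable_w hD.law_w hS (θ := 1)
      (2 * n * u + 5 * L)
    simp only [one_mul] at h
    refine h.trans (Real.exp_le_exp.2 ?_)
    have h1 : M.law.real S * (Real.exp 1 - 1) ≤ u * 2 := by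
      have h2 := Real.exp_one_lt_d9
      have h3 := Real.add_one_le_exp (1 : ℝ)
      exact mul_le_mul hSu (by linarith) (by linarith) hu
    have := mul_le_mul_of_nonneg_left h1 (Nat.cast_nonneg n : (0 : ℝ) ≤ n)
    linarith
  have hcell : ∀ k : Fin (⌊4 / l⌋₊ + 1), P.real {ω | ((k : ℕ) + 2) * (l / 4) ≤ 1 ∧
      ∑ i, (M.quantileCell (l / 4) k).indicator (fun _ => (1 : ℝ)) (M.w i ω) < n * l / 8} ≤
        Real.exp (-(n * l / 8)) := by
    intro k
    by_cases hk : (((k : ℕ) : ℝ) + 2) * (l / 4) ≤ 1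
    -- A negative parameter turns the Chernoff bound into a lower tail. The cell has mass at least
    -- `l / 2` and `exp (-1) - 1 ≤ -1/2`, so the exponent is at most `-n l / 4 + n l / 8`.
    · have h := measureReal_le_card_le hD.indep_w M.measurable_w hD.law_w
        (M.measurableSet_quantileCell (l / 4) k) (θ := -1) (-(n * l / 8))
      refine (measureReal_mono fun ω hω => ?_).trans (h.trans (Real.exp_le_exp.2 ?_))
      · have := hω.2
        simp only [Set.mem_ofPred_eq]
        linarith
      · have h1 := M.le_law_quantileCell (by positivity) hk
        have h2 : Real.exp (-1) ≤ 1 / 2 := by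
          rw [Real.exp_neg, ← one_div]
          refine one_div_le_one_div_of_le (by norm_num) ?_
          have := Real.add_one_le_exp (1 : ℝ)
          linarith
        have h3 : M.law.real (M.quantileCell (l / 4) k) * (Real.exp (-1) - 1) ≤
            2 * (l / 4) * (-(1 / 2)) := by nlinarith
        have := mul_le_mul_of_nonneg_left h3 (Nat.cast_nonneg n : (0 : ℝ) ≤ n)
        linarith
    · have e : {ω | ((k : ℕ) + 2) * (l / 4) ≤ 1 ∧
          ∑ i, (M.quantileCell (l / 4) k).indicator (fun _ => (1 : ℝ)) (M.w i ω) < n * l / 8} =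
            ∅ := by
        ext ω; simp [hk]
      rw [e, measureReal_empty]
      positivity
  have hsub : {ω | ¬M.RegularSample l u L j fun i => M.w i ω} ⊆
      ({ω | 2 * n * u + 5 * L ≤
          ∑ i, (M.leftExcess u j).indicator (fun _ => (1 : ℝ)) (M.w i ω)} ∪
        {ω | 2 * n * u + 5 * L ≤
          ∑ i, (M.rightExcess u j).indicator (fun _ => (1 : ℝ)) (M.w i ω)}) ∪
        {ω | ∃ k : Fin (⌊4 / l⌋₊ + 1), ((k : ℕ) + 2) * (l / 4) ≤ 1 ∧
          ∑ i, (M.quantileCell (l / 4) k).indicator (fun _ => (1 : ℝ)) (M.w i ω) <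
            n * l / 8} := by
    intro ω hω
    by_contra hcon
    simp only [Set.mem_union, Set.mem_ofPred_eq, not_or, not_exists, not_and, not_lt,
      not_le] at hcon
    refine hω ⟨hcon.1.1.le, hcon.1.2.le, fun k hk => ?_⟩
    have hk' : k ≤ ⌊4 / l⌋₊ := by
      refine Nat.le_floor ?_
      rw [le_div_iff₀ hl]
      have : 0 ≤ 2 * (l / 4) := by positivity
      linarith
    exact hcon.2 ⟨k, by omega⟩ hk
  refine (measureReal_mono hsub).trans ((measureReal_union_le _ _).trans
    ((add_le_add (measureReal_union_le _ _) (measureReal_exists_le hcell)).trans ?_))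
  have h1 := hside _ (M.measurableSet_leftExcess u j) (M.law_leftExcess_le hu j)
  have h2 := hside _ (M.measurableSet_rightExcess u j) (M.law_rightExcess_le hu j)
  have h3 : (Fintype.card (Fin (⌊4 / l⌋₊ + 1)) : ℝ) * Real.exp (-(n * l / 8)) ≤
      (4 / l + 1) * Real.exp (-(n * l / 8)) := by
    refine mul_le_mul_of_nonneg_right ?_ (Real.exp_pos _).le
    rw [Fintype.card_fin]
    push_cast
    linarith [Nat.floor_le (by positivity : 0 ≤ 4 / l)]
  linarith

theorem DistributionAssumptions.mul_norm_sq_le [IsProbabilityMeasure P]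
    (hD : M.DistributionAssumptions P σx σε κ φ) (i : Fin n) (v : EuclideanSpace ℝ (Fin p)) :
    κ * ‖v‖ ^ 2 ≤ ∫ ω, inner ℝ (M.x i ω) v ^ 2 ∂P := by
  have hcoord : ∀ k, MemLp (fun ω => M.x i ω k) 2 P := by
    intro k
    have h := (hD.subgaussian_x i (EuclideanSpace.single k 1) (by simp)).memLp 2
    simp only [EuclideanSpace.inner_single_right] at h
    simpa using h
  have hint : ∀ k l, Integrable (fun ω => M.x i ω k * M.x i ω l) P := fun k l =>
    (hcoord k).integrable_mul (hcoord l)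
  have h := hD.eigen_lower i v
  have e1 : (v : Fin p → ℝ) ⬝ᵥ v = ‖v‖ ^ 2 := by
    rw [EuclideanSpace.real_norm_sq_eq, dotProduct]
    exact Finset.sum_congr rfl fun k _ => (sq _).symm
  have e2 : ∫ ω, inner ℝ (M.x i ω) v ^ 2 ∂P =
      (v : Fin p → ℝ) ⬝ᵥ (M.covMatrix P i).mulVec v := by
    have e3 : ∀ ω, inner ℝ (M.x i ω) v ^ 2 =
        ∑ k, ∑ l, v k * v l * (M.x i ω k * M.x i ω l) := by
      intro ω
      rw [PiLp.inner_apply, sq, Finset.sum_mul_sum]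
      refine Finset.sum_congr rfl fun k _ => Finset.sum_congr rfl fun l _ => ?_
      simp
      ring
    simp only [e3]
    rw [integral_finsetSum _ fun k _ => integrable_finsetSum _ fun l _ => (hint k l).const_mul _]
    rw [dotProduct]
    refine Finset.sum_congr rfl fun k _ => ?_
    rw [integral_finsetSum _ fun l _ => (hint k l).const_mul _, Matrix.mulVec, dotProduct,
      Finset.mul_sum]
    refine Finset.sum_congr rfl fun l _ => ?_
    rw [integral_const_mul, covMatrix, Matrix.of_apply]
    ring
  rw [e1] at h
  rwa [e2]

/-- A probability bound for the predictors on every fixed set of indices holds on the blocks. -/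
theorem DistributionAssumptions.measureReal_block_le [IsProbabilityMeasure P]
    (hD : M.DistributionAssumptions P σx σε κ φ)
    {S : Finset (Fin n) → (Fin n → EuclideanSpace ℝ (Fin p)) → (Fin n → ℝ) → (Fin n → ℝ) → Prop}
    (hS : ∀ A, MeasurableSet
      {z : (Fin n → EuclideanSpace ℝ (Fin p)) × (Fin n → ℝ) × (Fin n → ℝ) | S A z.1 z.2.1 z.2.2})
    {δ : ℝ} (hδ : ∀ A w e, P.real {ω | S A (fun i => M.x i ω) w e} ≤ δ) (m : Fin n × Fin n) :
    P.real {ω | S (block (fun i => M.w i ω) m) (fun i => M.x i ω) (fun i => M.w i ω)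
      fun i => M.noise i ω} ≤ δ :=
  hD.indep_x_rest.measureReal_mem_le
    (measurable_pi_lambda _ M.measurable_x)
    ((measurable_pi_lambda _ M.measurable_w).prodMk (measurable_pi_lambda _ M.measurable_noise))
    (B := {z | S (block z.2.1 m) z.1 z.2.1 z.2.2})
    (measurableSet_block (w := fun z : (Fin n → EuclideanSpace ℝ (Fin p)) × (Fin n → ℝ) ×
      (Fin n → ℝ) => z.2.1) (by fun_prop) m hS)
    (fun y => hδ (block y.1 m) y.1 y.2)

/-- The noise score is conditioned on the event that the errors have energy at most `8 σε² n`, which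
fails with probability at most `exp (-n)`. All other events are handled with `w` and the errors
frozen, then summed over blocks, coordinates and sign patterns. -/
theorem DistributionAssumptions.measureReal_not_regularDesign_le [IsProbabilityMeasure P]
    (hD : M.DistributionAssumptions P σx σε κ φ) (hσx : 0 < σx) (hσε : 0 < σε) (hn : 0 < n)
    {θ b L Q V : ℝ} (hθ : 0 < θ) (hθσ : θ * (4 * (σx : ℝ) ^ 2) ≤ 1)
    (hθκ : 128 * (σx : ℝ) ^ 4 * θ ≤ κ) (hL : 0 < L) (hQ : 0 < Q) (k : ℕ) :
    P.real {ω | ¬M.RegularDesign (κ / 2) (8 * σx ^ 2) b (9 * σx * σε * (n * √(L / n))) Q V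
      (8 * σx ^ 2 * (Q * (5 * L) + V / 2)) k
      (fun i => M.x i ω) (fun i => M.w i ω) fun i => M.noise i ω} ≤
      Real.exp (-n) + (n : ℝ) ^ 2 * (2 * p) ^ k * Real.exp (-(θ * κ / 4) * b) +
        (n : ℝ) ^ 2 * p * Real.exp (-b) + 4 * ((n : ℝ) ^ 2 * p * Real.exp (-(5 * L))) := by
  have hσx' : (0 : ℝ) < σx := hσx
  have hσε' : (0 : ℝ) < σε := hσε
  have hn' : (0 : ℝ) < n := by exact_mod_cast hn
  have hκ : 0 ≤ κ := le_trans (by positivity) hθκ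
  have hcoord : ∀ (v : EuclideanSpace ℝ (Fin p)) l,
      v l = inner ℝ v (EuclideanSpace.single l (1 : ℝ)) := fun v l => by
    simp [EuclideanSpace.inner_single_right]
  have hunit : ∀ l : Fin p, ‖EuclideanSpace.single l (1 : ℝ)‖ = 1 := fun l => by simp
  have hnoise : P.real {ω | 8 * (σε : ℝ) ^ 2 * n < ∑ i, M.noise i ω ^ 2} ≤ Real.exp (-n) := by
    have h := measureReal_lt_sum_sq_le hD.indep_noise M.measurable_noise hσε
      hD.subgaussian_noise Finset.univ
    simpa using h
  have hsparse : ∀ mf : (Fin n × Fin n) × (Fin k → Fin p × Bool),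
      P.real {ω | b ≤ (block (fun i => M.w i ω) mf.1).card ∧
        ∑ i ∈ block (fun i => M.w i ω) mf.1,
          inner ℝ (M.x i ω) (∑ i, signedBasis p (mf.2 i)) ^ 2 <
        κ / 2 * (block (fun i => M.w i ω) mf.1).card * ‖∑ i, signedBasis p (mf.2 i)‖ ^ 2} ≤
      Real.exp (-(θ * κ / 4) * b) := by
    rintro ⟨m, f⟩
    refine hD.measureReal_block_le (S := fun A x _ _ => b ≤ A.card ∧
      ∑ i ∈ A, inner ℝ (x i) (∑ i, signedBasis p (f i)) ^ 2 <
        κ / 2 * A.card * ‖∑ i, signedBasis p (f i)‖ ^ 2) (fun A => ?_) (fun A w e => ?_) m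
    · exact measurableSet_and (MeasurableSet.const _) (measurableSet_lt (by fun_prop) measurable_const)
    · by_cases hb : b ≤ A.card
      · have h := measureReal_sum_inner_sq_lt_le hD.indep_x M.measurable_x hσx hD.subgaussian_x
          hθ hθσ hθκ hD.mul_norm_sq_le A (∑ i, signedBasis p (f i))
        simp only [hb, true_and]
        refine h.trans (Real.exp_le_exp.2 ?_)
        have : 0 ≤ θ * κ / 4 := by positivity
        nlinarith
      · simp [hb, Real.exp_nonneg]
  have hdiag : ∀ ml : (Fin n × Fin n) × Fin p,
      P.real {ω | b ≤ (block (fun i => M.w i ω) ml.1).card ∧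
        8 * (σx : ℝ) ^ 2 * (block (fun i => M.w i ω) ml.1).card <
        ∑ i ∈ block (fun i => M.w i ω) ml.1, M.x i ω ml.2 ^ 2} ≤ Real.exp (-b) := by
    rintro ⟨m, l⟩
    refine hD.measureReal_block_le (S := fun A x _ _ => b ≤ A.card ∧
      8 * (σx : ℝ) ^ 2 * A.card < ∑ i ∈ A, x i l ^ 2) (fun A => ?_) (fun A w e => ?_) m
    · exact measurableSet_and (MeasurableSet.const _) (measurableSet_lt measurable_const (by fun_prop))
    · by_cases hb : b ≤ A.card
      · have h := measureReal_lt_sum_sq_le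
          (X := fun i ω => inner ℝ (M.x i ω) (EuclideanSpace.single l (1 : ℝ)))
          (hD.indep_x.comp (fun _ z => inner ℝ z (EuclideanSpace.single l (1 : ℝ)))
            fun _ => by fun_prop)
          (fun i => by have := M.measurable_x i; fun_prop) hσx
          (fun i => hD.subgaussian_x i _ (hunit l)) A
        simp only [← hcoord] at h
        simp only [hb, true_and]
        exact h.trans (Real.exp_le_exp.2 (neg_le_neg hb))
      · simp [hb, Real.exp_nonneg]
  have hscore : ∀ ml : (Fin n × Fin n) × Fin p,
      P.real {ω | ∑ i, M.noise i ω ^ 2 ≤ 8 * (σε : ℝ) ^ 2 * n ∧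
        9 * σx * σε * (n * √(L / n)) <
        |∑ i ∈ block (fun i => M.w i ω) ml.1, M.noise i ω * M.x i ω ml.2|} ≤
      2 * Real.exp (-(5 * L)) := by
    rintro ⟨m, l⟩
    refine hD.measureReal_block_le (S := fun A x _ e => ∑ i, e i ^ 2 ≤ 8 * (σε : ℝ) ^ 2 * n ∧
      9 * σx * σε * (n * √(L / n)) < |∑ i ∈ A, e i * x i l|) (fun A => ?_) (fun A w e => ?_) m
    · exact measurableSet_and (measurableSet_le (by fun_prop) measurable_const)
        (measurableSet_lt measurable_const (by fun_prop))
    · by_cases he : ∑ i, e i ^ 2 ≤ 8 * (σε : ℝ) ^ 2 * n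
      -- With this `t` the quadratic term is `4 L` and the linear term `9 L`, which leaves `-5 L`.
      · have h := measureReal_lt_abs_sum_mul_inner_le hD.indep_x M.measurable_x hD.subgaussian_x
          A e (V := 8 * (σε : ℝ) ^ 2 * n) (t := √(L / n) / (σx * σε))
          (T := 9 * σx * σε * (n * √(L / n))) (L := 5 * L)
          ((Finset.sum_le_sum_of_subset_of_nonneg (Finset.subset_univ A)
            fun _ _ _ => sq_nonneg _).trans he) ?_ (by positivity)
          (EuclideanSpace.single l (1 : ℝ)) (hunit l)
        · simp only [← hcoord] at h
          simpa only [he, true_and] using h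
        · have hsq : √(L / n) ^ 2 = L / n := Real.sq_sqrt (by positivity)
          refine le_of_eq ?_
          calc _ = (8 * n / 2 - 9 * n) * √(L / n) ^ 2 := by field_simp
            _ = -(5 * L) := by rw [hsq]; field_simp; ring
      · simp [he, Real.exp_nonneg]
  have hbias : ∀ ml : (Fin n × Fin n) × Fin p,
      P.real {ω | (∀ i ∈ block (fun i => M.w i ω) ml.1,
          ‖M.deviation (fun i => M.w i ω) (block (fun i => M.w i ω) ml.1) i‖ ≤ 2 * Q) ∧
        ∑ i ∈ block (fun i => M.w i ω) ml.1,
          ‖M.deviation (fun i => M.w i ω) (block (fun i => M.w i ω) ml.1) i‖ ^ 2 ≤ Q * V ∧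
        8 * (σx : ℝ) ^ 2 * (Q * (5 * L) + V / 2) < |∑ i ∈ block (fun i => M.w i ω) ml.1,
          inner ℝ (M.x i ω) (M.deviation (fun i => M.w i ω) (block (fun i => M.w i ω) ml.1) i) *
            M.x i ω ml.2|} ≤
      2 * Real.exp (-(5 * L)) := by
    rintro ⟨m, l⟩
    refine hD.measureReal_block_le (S := fun A x w _ => (∀ i ∈ A, ‖M.deviation w A i‖ ≤ 2 * Q) ∧
      ∑ i ∈ A, ‖M.deviation w A i‖ ^ 2 ≤ Q * V ∧ 8 * (σx : ℝ) ^ 2 * (Q * (5 * L) + V / 2) <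
        |∑ i ∈ A, inner ℝ (x i) (M.deviation w A i) * x i l|) (fun A => ?_) (fun A w e => ?_) m
    · have hdev : ∀ i, Measurable fun z : (Fin n → EuclideanSpace ℝ (Fin p)) × (Fin n → ℝ) ×
          (Fin n → ℝ) => M.deviation z.2.1 A i := by
        intro i
        have h1 : ∀ i, Measurable fun z : (Fin n → EuclideanSpace ℝ (Fin p)) × (Fin n → ℝ) ×
          (Fin n → ℝ) => M.coefAt (z.2.1 i) := fun i =>
            M.measurable_coefAt.comp (by fun_prop)
        exact (h1 i).sub ((Finset.measurable_sum A fun i _ => h1 i).const_smul (A.card : ℝ)⁻¹)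
      refine measurableSet_and ?_ (measurableSet_and ?_ ?_)
      · have e : {z : (Fin n → EuclideanSpace ℝ (Fin p)) × (Fin n → ℝ) × (Fin n → ℝ) |
            ∀ i ∈ A, ‖M.deviation z.2.1 A i‖ ≤ 2 * Q} =
            ⋂ i ∈ A, {z | ‖M.deviation z.2.1 A i‖ ≤ 2 * Q} := by
          ext z; simp
        rw [e]
        exact Finset.measurableSet_biInter A fun i _ =>
          measurableSet_le (hdev i).norm measurable_const
      · exact measurableSet_le (by fun_prop) measurable_const
      · exact measurableSet_lt measurable_const (by fun_prop)
    · by_cases h1 : (∀ i ∈ A, ‖M.deviation w A i‖ ≤ 2 * Q) ∧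
        ∑ i ∈ A, ‖M.deviation w A i‖ ^ 2 ≤ Q * V
      · have h := measureReal_lt_abs_sum_inner_mul_inner_le hD.indep_x M.measurable_x hD.ident_x
          hσx hD.subgaussian_x A (M.deviation w A) (sum_sub_average A _) hQ h1.1 h1.2 (L := 5 * L)
          (EuclideanSpace.single l (1 : ℝ)) (hunit l)
        simp only [← hcoord] at h
        exact (measureReal_mono fun ω hω => hω.2.2).trans h
      · have e : {ω | (∀ i ∈ A, ‖M.deviation w A i‖ ≤ 2 * Q) ∧
            ∑ i ∈ A, ‖M.deviation w A i‖ ^ 2 ≤ Q * V ∧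
            8 * (σx : ℝ) ^ 2 * (Q * (5 * L) + V / 2) <
              |∑ i ∈ A, inner ℝ (M.x i ω) (M.deviation w A i) * M.x i ω l|} = ∅ := by
          ext ω
          simp only [Set.mem_ofPred_eq, Set.mem_empty_iff_false, iff_false]
          exact fun h => h1 ⟨h.1, h.2.1⟩
        rw [e, measureReal_empty]
        positivity
  have h := measureReal_or_le hnoise (measureReal_or_le (measureReal_exists_le hsparse)
    (measureReal_or_le (measureReal_exists_le hdiag)
      (measureReal_or_le (measureReal_exists_le hscore) (measureReal_exists_le hbias))))
  refine (measureReal_mono fun ω hω => ?_).trans (h.trans (le_of_eq ?_))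
  · by_contra hcon
    simp only [Set.mem_ofPred_eq, not_or, not_exists, not_and, not_lt, Prod.forall] at hcon
    obtain ⟨h1, h2, h3, h4, h5⟩ := hcon
    exact hω ⟨fun m f => h2 m.1 m.2 f, fun m => h3 m.1 m.2, fun m l => h4 m.1 m.2 l h1,
      fun m l => h5 m.1 m.2 l⟩
  · simp only [Fintype.card_prod, Fintype.card_fin, Fintype.card_pi, Fintype.card_bool,
      Finset.prod_const, Finset.card_univ]
    push_cast
    ring

end Model

/-! ### The total failure probability. -/

namespace Model

variable {Ω : Type*} [MeasurableSpace Ω] {n p N : ℕ} {M : Model Ω n p N} {P : Measure Ω}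
  {σx σε : ℝ≥0} {κ φ : ℝ}

/-- Each event fails with probability of order `exp (-5 L) = p ^ (-5)`, and the union bounds cost at
most a constant times `p ^ 3`. The condition `40 ≤ R` gives `n l / 8 ≥ 5 L`; the condition on `θ κ
R` pays for the `(2 p) ^ k` sign patterns. The count `14` is `2 + 5` for the sample and `1 + 1 + 1 +
4` for the design. -/
theorem DistributionAssumptions.measureReal_not_regular_le [IsProbabilityMeasure P]
    (hD : M.DistributionAssumptions P σx σε κ φ) (hσx : 0 < σx) (hσε : 0 < σε) (hκ : 0 < κ)
    (hn : 2 ≤ n) (hnp : n ≤ p) {θ l u Q V K R : ℝ} {s k : ℕ} (hθ : 0 < θ)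
    (hθσ : θ * (4 * (σx : ℝ) ^ 2) ≤ 1) (hθκ : 128 * (σx : ℝ) ^ 4 * θ ≤ κ) (hl : 0 < l)
    (hl1 : l ≤ 1) (hu : 0 ≤ u) (hQ : 0 < Q) (hs : 1 ≤ s) (hk : k ≤ K * s) (hR : 40 ≤ R)
    (hKR : 32 * (2 * K + 5) ≤ θ * κ * R) (hsl : R * (s * Real.log p) ≤ n * l ^ 2)
    (j : Fin (N + 1)) :
    P.real {ω | ¬(M.RegularSample l u (Real.log p) j fun i => M.w i ω) ∨
      ¬M.RegularDesign (κ / 2) (8 * σx ^ 2) (n * l / 8)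
        (9 * σx * σε * (n * √(Real.log p / n))) Q V
        (8 * σx ^ 2 * (Q * (5 * Real.log p) + V / 2)) k
        (fun i => M.x i ω) (fun i => M.w i ω) fun i => M.noise i ω} ≤
      14 * Real.exp (-2 * Real.log p) := by
  set L := Real.log p with hLdef
  have hp2 : (2 : ℝ) ≤ p := by exact_mod_cast hn.trans hnp
  have hn2 : (2 : ℝ) ≤ n := by exact_mod_cast hn
  have hnp' : (n : ℝ) ≤ p := by exact_mod_cast hnp
  have hs' : (1 : ℝ) ≤ s := by exact_mod_cast hs
  have hp0 : (0 : ℝ) < p := by linarith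
  have hexpL : Real.exp L = p := Real.exp_log hp0
  have hL2 : 1 / 2 ≤ L := by
    have h1 := Real.log_two_gt_d9
    have h2 := Real.log_le_log (by norm_num) hp2
    linarith
  have hL : 0 < L := by linarith
  have hsL : L ≤ s * L := le_mul_of_one_le_left hL.le hs'
  have hnl : R * (s * L) ≤ n * l :=
    hsl.trans (mul_le_mul_of_nonneg_left (by nlinarith) (by positivity))
  have hRL : 40 * L ≤ R * (s * L) := mul_le_mul hR hsL hL.le (by linarith)
  have hnl1 : n * l ≤ n := mul_le_of_le_one_right (by positivity) hl1
  set ε := Real.exp (-(5 * L)) with hε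
  have hε0 : 0 < ε := Real.exp_pos _
  have h1 : Real.exp (-(n * l / 8)) ≤ ε := Real.exp_le_exp.2 (by linarith)
  have h2 : Real.exp (-(n : ℝ)) ≤ ε := Real.exp_le_exp.2 (by linarith)
  have h3 : (2 * (p : ℝ)) ^ k * Real.exp (-(θ * κ / 4) * (n * l / 8)) ≤ ε := by
    have h4 : (2 * (p : ℝ)) ^ k ≤ Real.exp (2 * k * L) := by
      have e : Real.exp (2 * k * L) = ((p : ℝ) * p) ^ k := by
        rw [← hexpL, ← Real.exp_add, ← Real.exp_nat_mul]; congr 1; ring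
      rw [e]
      gcongr
    refine (mul_le_mul_of_nonneg_right h4 (Real.exp_pos _).le).trans ?_
    rw [← Real.exp_add]
    refine Real.exp_le_exp.2 ?_
    have h5 : k * L ≤ K * s * L := mul_le_mul_of_nonneg_right hk hL.le
    have h6 : θ * κ * (R * (s * L)) ≤ θ * κ * (n * l) :=
      mul_le_mul_of_nonneg_left hnl (by positivity)
    have h7 : 32 * (2 * K + 5) * (s * L) ≤ θ * κ * R * (s * L) :=
      mul_le_mul_of_nonneg_right hKR (by positivity)
    linarith
  have h4 : 4 / l + 1 ≤ 5 * p := by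
    have : 4 / l ≤ 4 * n := by
      rw [div_le_iff₀ hl]
      linarith
    linarith
  have e1 := hD.measureReal_not_regularSample_le (L := L) hl hu j
  have e2 := hD.measureReal_not_regularDesign_le hσx hσε (by omega) (b := n * l / 8) (V := V)
    hθ hθσ hθκ hL hQ k
  refine (measureReal_or_le e1 e2).trans ?_
  have hp1 : (1 : ℝ) ≤ p := by linarith
  have e3 : Real.exp (-2 * L) = (p : ℝ) ^ 3 * ε := by
    rw [← hexpL, ← Real.exp_nat_mul, hε, ← Real.exp_add]; congr 1; push_cast; ring
  rw [e3]
  have f1 : ε ≤ (p : ℝ) ^ 3 * ε := le_mul_of_one_le_left hε0.le (one_le_pow₀ hp1)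
  have f2 : (4 / l + 1) * Real.exp (-(n * l / 8)) ≤ 5 * ((p : ℝ) ^ 3 * ε) := by
    refine (mul_le_mul h4 h1 (Real.exp_pos _).le (by positivity)).trans ?_
    rw [mul_assoc]
    gcongr
    exact le_self_pow₀ hp1 (by norm_num)
  have f3 : (n : ℝ) ^ 2 * (2 * p) ^ k * Real.exp (-(θ * κ / 4) * (n * l / 8)) ≤
      (p : ℝ) ^ 3 * ε := by
    rw [mul_assoc]
    refine mul_le_mul ?_ h3 (by positivity) (by positivity)
    calc (n : ℝ) ^ 2 ≤ (p : ℝ) ^ 2 := by gcongr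
      _ ≤ (p : ℝ) ^ 3 := pow_le_pow_right₀ hp1 (by norm_num)
  have f4 : (n : ℝ) ^ 2 * p ≤ (p : ℝ) ^ 3 := by
    calc (n : ℝ) ^ 2 * p ≤ (p : ℝ) ^ 2 * p := by gcongr
      _ = (p : ℝ) ^ 3 := by ring
  have f5 : (n : ℝ) ^ 2 * p * Real.exp (-(n * l / 8)) ≤ (p : ℝ) ^ 3 * ε :=
    mul_le_mul f4 h1 (Real.exp_pos _).le (by positivity)
  have f6 : (n : ℝ) ^ 2 * p * ε ≤ (p : ℝ) ^ 3 * ε := mul_le_mul_of_nonneg_right f4 hε0.le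
  linarith

end Model
end ChangePoint

/-! ### The main theorem: choice of constants and assembly. -/

theorem mainTheorem4 (σx σε : ℝ≥0) (κ φ csep cjump : ℝ) (hσx : 0 < σx) (hσε : 0 < σε)
    (hκ : 0 < κ) (hκφ : κ ≤ φ) (hcsep : 0 < csep) (hcjump : 0 < cjump) :
    -- constants depending only on the parameters above
    ∃ clam C c₁ c₂ : ℝ, 0 < clam ∧ 0 < C ∧ 0 < c₁ ∧ 0 < c₂ ∧
      ∀ (Ω : ℕ → Type*) [∀ n, MeasurableSpace (Ω n)] (P : ∀ n, Measure (Ω n))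
        [∀ n, IsProbabilityMeasure (P n)] (p s N : ℕ → ℕ) (lmin u : ℕ → ℝ)
        (M : ∀ n, ChangePoint.Model (Ω n) n (p n) (N n)),
        -- high dimensional setting
        (∀ᶠ n in atTop, n ≤ p n) →
        -- sparsity
        (∀ n, 1 ≤ s n) → (∀ n, (M n).support.ncard ≤ s n) →
        -- model dimensions
        (∀ n, 0 < lmin n) →
        Tendsto (fun n : ℕ => (s n : ℝ) * Real.log (p n) / ((n : ℝ) * lmin n ^ 2)) atTop (𝓝 0) →
        -- separation of the change points
        (∀ n, ∀ j : Fin (N n), csep * lmin n ≤ (M n).d ((M n).tau j) ((M n).tau (j + 1))) →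
        -- distributions
        (∀ n, (M n).DistributionAssumptions (P n) σx σε κ φ) →
        -- neighbourhood size
        (∀ n, 0 ≤ u n) →
        (fun n => Real.log (u n)⁻¹) =O[atTop] (fun n => Real.log (p n)) →
        -- neighbourhood size against the largest jump
        (∀ᶠ n : ℕ in atTop, (M n).jumpMax * (Real.log (p n) / n) ≤ cjump * (M n).rate (u n)) →
        ∀ᶠ n in atTop, ∀ j : Fin (N n + 1), ∃ E : Set (Ω n), MeasurableSet E ∧
          1 - c₁ * Real.exp (-c₂ * Real.log (p n)) ≤ (P n).real E ∧
          ∀ ω ∈ E, ∀ q ∈ (M n).segments (lmin n) (u n) j,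
            ∀ α : EuclideanSpace ℝ (Fin (p n)),
              (M n).IsLasso (clam * (M n).rate (u n)) q.1 q.2 ω α →
              ChangePoint.l1norm (α - (M n).coef j) ≤
                  C * (s n : ℝ) * (M n).rate (u n) / lmin n ∧
              ‖α - (M n).coef j‖ ≤ C * √(s n : ℝ) * (M n).rate (u n) / lmin n := by
  have hσx' : (0 : ℝ) < σx := hσx
  have hσε' : (0 : ℝ) < σε := hσε
  set K : ℝ := 10 * (1 + 1 / csep) * (1 + cjump) + 1 with hK
  have hK0 : 0 < K := by positivity
  set θ : ℝ := min (1 / (4 * (σx : ℝ) ^ 2)) (κ / (128 * (σx : ℝ) ^ 4)) with hθdef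
  have hθ : 0 < θ := by positivity
  have hθσ : θ * (4 * (σx : ℝ) ^ 2) ≤ 1 := by
    have := min_le_left (1 / (4 * (σx : ℝ) ^ 2)) (κ / (128 * (σx : ℝ) ^ 4))
    rw [← hθdef, le_div_iff₀ (by positivity)] at this
    exact this
  have hθκ : 128 * (σx : ℝ) ^ 4 * θ ≤ κ := by
    have := min_le_right (1 / (4 * (σx : ℝ) ^ 2)) (κ / (128 * (σx : ℝ) ^ 4))
    rw [← hθdef, le_div_iff₀ (by positivity)] at this
    linarith
  set K₃ : ℝ := 512 * (σx : ℝ) ^ 2 / κ + 3 with hK₃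
  set R : ℝ := 40 + 32 * (2 * K₃ + 5) / (θ * κ) with hRdef
  have hR : 40 ≤ R := le_add_of_nonneg_right (by positivity)
  have hKR : 32 * (2 * K₃ + 5) ≤ θ * κ * R := by
    have e : θ * κ * R = θ * κ * 40 + 32 * (2 * K₃ + 5) := by rw [hRdef]; field_simp
    have : 0 ≤ θ * κ * 40 := by positivity
    linarith
  refine ⟨4 * (44 * (σx : ℝ) ^ 2 * K + 9 * σx * σε),
    192 * (4 * (44 * (σx : ℝ) ^ 2 * K + 9 * σx * σε)) / κ + 80 * (1 + 1 / csep) * (1 + cjump),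
    14, 2, by positivity, by positivity, by norm_num, by norm_num, ?_⟩
  intro Ω _ P _ p s N lmin u M hnp hs1 hs hlmin hlim hsep hD hu _ hjump
  have hRinv : (0 : ℝ) < 1 / R := by positivity
  filter_upwards [hnp, hlim.eventually_lt_const hRinv, hjump, eventually_ge_atTop 2]
    with n hnp hlim hjump hn j
  have hp2 : (2 : ℝ) ≤ p n := by exact_mod_cast hn.trans hnp
  have hn' : (0 : ℝ) < n := by exact_mod_cast (by omega : 0 < n)
  have hL : 0 < Real.log (p n) := Real.log_pos (by linarith)
  -- Distances in the cdf scale are at most `1`, so for `lmin n ≥ 1` no segment is admissible.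
  rcases le_or_gt 1 (lmin n) with hl1 | hl1
  · refine ⟨Set.univ, MeasurableSet.univ, ?_, fun ω _ q hq => ?_⟩
    · rw [probReal_univ]
      have := Real.exp_pos (-2 * Real.log (p n))
      linarith
    · have := hq.2.1.trans_le ((M n).d_le_one q.1 q.2)
      linarith
  have hl := hlmin n
  have hsl : R * (s n * Real.log (p n)) ≤ n * lmin n ^ 2 := by
    rw [div_lt_div_iff₀ (by positivity) (by positivity)] at hlim
    linarith
  have hs1' : (1 : ℝ) ≤ s n := by exact_mod_cast hs1 n
  have hLn : Real.log (p n) ≤ n * lmin n ^ 2 := by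
    refine le_trans ?_ hsl
    have h1 : Real.log (p n) ≤ s n * Real.log (p n) := le_mul_of_one_le_left hL.le hs1'
    exact h1.trans (le_mul_of_one_le_left (by positivity) (by linarith))
  have hr1 : √(Real.log (p n) / n) ≤ (M n).rate (u n) := le_max_left _ _
  have hr2 : (M n).jumpMax * u n ≤ (M n).rate (u n) := le_max_right _ _
  have hr : 0 < (M n).rate (u n) := lt_of_lt_of_le (Real.sqrt_pos.2 (by positivity)) hr1
  obtain ⟨Q, hQ, hQ1, hQ2, hQ3⟩ := ChangePoint.exists_scale hn' hL hl hl1.le hLn (hu n)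
    (M n).jumpMax_nonneg hcsep hcjump hr1 hr2 hjump
  -- The summand `3` covers rounding and the strict bound required by the transfer principle, while
  -- `k` stays at most a constant times `s`.
  set k : ℕ := ⌊512 * (σx : ℝ) ^ 2 * s n / κ⌋₊ + 3 with hk
  have hk1 : 512 * (σx : ℝ) ^ 2 * s n / κ + 1 < k := by
    have := Nat.lt_floor_add_one (512 * (σx : ℝ) ^ 2 * s n / κ)
    rw [hk]; push_cast; linarith
  have hk2 : (k : ℝ) ≤ K₃ * s n := by
    have := Nat.floor_le (by positivity : 0 ≤ 512 * (σx : ℝ) ^ 2 * s n / κ)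
    have e : K₃ * s n = 512 * (σx : ℝ) ^ 2 * s n / κ + 3 * s n := by rw [hK₃]; ring
    rw [e, hk]; push_cast; linarith
  have hbad := (hD n).measureReal_not_regular_le hσx hσε hκ hn hnp hθ hθσ hθκ hl hl1.le (hu n) hQ
    (hs1 n) hk2 hR hKR hsl (V := K * (n * (M n).rate (u n))) j
  set bad := {ω | ¬((M n).RegularSample (lmin n) (u n) (Real.log (p n)) j fun i => (M n).w i ω) ∨
      ¬(M n).RegularDesign (κ / 2) (8 * σx ^ 2) (n * lmin n / 8)
        (9 * σx * σε * (n * √(Real.log (p n) / n))) Q (K * (n * (M n).rate (u n)))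
        (8 * σx ^ 2 * (Q * (5 * Real.log (p n)) + K * (n * (M n).rate (u n)) / 2)) k
        (fun i => (M n).x i ω) (fun i => (M n).w i ω) fun i => (M n).noise i ω}
  -- A measurable hull has the same measure as the bad event, so measurability of the latter is not
  -- needed.
  refine ⟨(toMeasurable (P n) bad)ᶜ, (measurableSet_toMeasurable _ _).compl, ?_, ?_⟩
  · rw [probReal_compl_eq_one_sub (measurableSet_toMeasurable _ _), measureReal_def,
      measure_toMeasurable, ← measureReal_def]
    linarith
  · intro ω hω q hq α hα
    have hω' : ω ∉ bad := fun h => hω (subset_toMeasurable _ _ h)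
    simp only [bad, Set.mem_ofPred_eq, not_or, not_not] at hω'
    exact (M n).error_le_of_regular (by omega) hσx' hσε' hκ hcsep hcjump hl (hu n) hL hr hr1 hr2
      hjump (hs n) (hs1 n) (hsep n) hk1 hQ1 hK0 hQ2 hQ3 hω'.1 hω'.2 hq hα
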